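/- For every integer $n \ge 6$ with $n \ne 7$, there exists a simple graph $G$ with exactly $n$ vertices such that: $G$ is Hamiltonian, i.e. it has a cycle through all of its vertices; $G$ is maximal planar, i.e. it has an embedding in the plane and adding an edge between any two distinct non-adjacent vertices gives a graph that has no embedding in the plane; and $G$ is triangle decomposable, i.e. the edge set of $G$ can be partitioned into sets each of which is the edge set of a triangle (a copy of $K_3$). -/

import Mathlib

namespace SimpleGraph

/-- A plane embedding of `G`: vertices are distinct points of the plane `ℝ² = ℂ`, every edge is a
simple (continuous, injective) arc joining its two ends, an arc contains no vertex other than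
its ends, and two distinct arcs meet only in vertices (hence only in common ends). -/
structure PlaneEmbedding {V : Type*} (G : SimpleGraph V) where
  /-- the point that represents a vertex -/
  pt : V → ℂ
  /-- the parametrized arc that represents an edge -/
  arc : G.edgeSet → C(unitInterval, ℂ)
  pt_injective : Function.Injective pt
  arc_injective : ∀ e, Function.Injective (arc e)
  arc_ends : ∀ e, s(arc e 0, arc e 1) = Sym2.map pt (e : Sym2 V)
  mem_of_pt_mem_arc : ∀ e v, pt v ∈ Set.range (arc e) → v ∈ (e : Sym2 V)
  arc_inter_arc : ∀ e f, e ≠ f → Set.range (arc e) ∩ Set.range (arc f) ⊆ Set.range pt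

/-- A graph is planar if it has a plane embedding. -/
def IsPlanar {V : Type*} (G : SimpleGraph V) : Prop :=
  Nonempty G.PlaneEmbedding

/-- A graph is maximal planar if it is planar and adding any edge between two distinct
non-adjacent vertices gives a graph that is not planar. -/
def IsMaximalPlanar {V : Type*} (G : SimpleGraph V) : Prop :=
  G.IsPlanar ∧ ∀ u v : V, u ≠ v → ¬ G.Adj u v → ¬ (G ⊔ edge u v).IsPlanar

/-- The set `T` is the set of the three edges of a triangle, i.e. of a copy of `K₃`. -/
def IsTriangleEdgeSet {V : Type*} (T : Set (Sym2 V)) : Prop :=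
  ∃ a b c : V, a ≠ b ∧ a ≠ c ∧ b ≠ c ∧ T = {s(a, b), s(a, c), s(b, c)}

/-- A graph is triangle decomposable if its edge set can be partitioned into edge sets of
triangles. -/
def IsTriangleDecomposable {V : Type*} (G : SimpleGraph V) : Prop :=
  ∃ P : Set (Set (Sym2 V)),
    (∀ T ∈ P, IsTriangleEdgeSet T) ∧ P.PairwiseDisjoint id ∧ ⋃₀ P = G.edgeSet

end SimpleGraph

/-!
The graph is, for even `n`, the bipyramid over a cycle of even length `m = n - 2`: the rim cycle
together with two apexes `north` and `south` that are adjacent to the whole rim. For odd `n`, `m` is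
`n - 5`, and one face of the bipyramid, `north, 0, 1`, is filled by an octahedron: three inner
vertices form a triangle, and each of them is adjacent to two corners of the face
(`bipyramid m k` with `k = 0` or `k = 3`).

These graphs have an explicit drawing (`bipyramid_three_isPlanar`). The rim lies on the vertical
axis, and all edges are segments except the one that closes the rim, which is an arc of a parabola
that passes around everything else. Two segments are kept apart by a suitable line
(`LineSeparates`), and the parabola bounds a convex region that contains all segments.

Every graph obtained by a new edge contains a `K₃,₃` with at most one subdivided edge, so that
maximality needs no Euler formula and no Jordan curve theorem, but just the topological
nonplanarity of `K₃,₃`. This is proved by van Kampen's parity argument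
(`not_exists_drawing_completeBipartite`). For two disjoint edges `e` and `f`, the difference
`e s - f t` is a nonvanishing function on a square, hence has a continuous logarithm there; going
around the square gives a linear relation between the changes of logarithm of an edge as seen from
the ends of the other. These changes are differences of principal logarithms up to multiples of
`2 * π * I`, and the 18 relations obtained in this way from `K₃,₃` contradict each other modulo `4`.

Finally, the faces of a bipyramid with even rim can be coloured alternately, and the faces of one
colour decompose the edges. The filled triangle `north, 0, 1` is kept in this decomposition, and the
octahedron contributes those of its faces that meet the filled face
in a single corner (`triangle`). The Hamiltonian cycle runs through `north`, the inner vertices,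
`0`, `south` and the remaining rim.
-/

/-! ### Logarithms along curves -/

open Complex

/-- `δ` is the total change of a continuous logarithm along the curve `f`, which therefore
avoids the origin. -/
def HasLogChange (f : unitInterval → ℂ) (δ : ℂ) : Prop :=
  ∃ g : C(unitInterval, ℂ), (∀ t, exp (g t) = f t) ∧ g 1 - g 0 = δ

/-- A continuous nonvanishing function on the square has a continuous logarithm. The square is
replaced by `ℝ × ℝ`, on which lifts along the covering map `exp` are available. -/
theorem exists_log_square {F : unitInterval × unitInterval → ℂ} (hF : Continuous F)
    (h0 : ∀ x, F x ≠ 0) :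
    ∃ g : C(unitInterval × unitInterval, ℂ), ∀ x, exp (g x) = F x := by
  have h01 : (0 : ℝ) ≤ 1 := zero_le_one
  let F' : C(ℝ × ℝ, ℂ) :=
    ⟨fun x ↦ F (Set.projIcc 0 1 h01 x.1, Set.projIcc 0 1 h01 x.2), by
      have := continuous_projIcc (h := h01)
      fun_prop⟩
  obtain ⟨g, ⟨-, hg⟩, -⟩ := isCoveringMapOn_exp.existsUnique_continuousMap_lifts F'
    (a₀ := 0) (exp_log (h0 _)) (fun x ↦ h0 _)
  refine ⟨⟨fun x ↦ g (x.1, x.2), by fun_prop⟩, fun x ↦ ?_⟩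
  have := congrFun hg (x.1, x.2)
  simpa [F'] using this

theorem HasLogChange.unique {f : unitInterval → ℂ} {δ δ' : ℂ} (h : HasLogChange f δ)
    (h' : HasLogChange f δ') : δ = δ' := by
  obtain ⟨g, hg, rfl⟩ := h
  obtain ⟨g', hg', rfl⟩ := h'
  obtain ⟨n, hn⟩ := exp_eq_exp_iff_exists_int.1 ((hg 0).trans (hg' 0).symm)
  have key := isCoveringMap_exp.eq_of_comp_eq (A := unitInterval) (g₁ := g)
    (g₂ := fun t ↦ g' t + n * (2 * Real.pi * I)) (by fun_prop) (by fun_prop)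
    (by
      funext t
      simp only [Function.comp_apply, Subtype.mk.injEq]
      rw [hg, ← hg', exp_eq_exp_iff_exists_int]
      exact ⟨-n, by push_cast; ring⟩) 0 hn
  rw [congrFun key 1, hn]
  ring

theorem HasLogChange.neg {f : unitInterval → ℂ} {δ : ℂ} (h : HasLogChange f δ) :
    HasLogChange (fun t ↦ -f t) δ := by
  obtain ⟨g, hg, rfl⟩ := h
  refine ⟨⟨fun t ↦ g t + Real.pi * I, by fun_prop⟩, fun t ↦ ?_, ?_⟩
  · simp [exp_add, hg]
  · simp

theorem HasLogChange.exists_int {f : unitInterval → ℂ} {δ : ℂ} (h : HasLogChange f δ) :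
    ∃ k : ℤ, δ = log (f 1) - log (f 0) + k * (2 * Real.pi * I) := by
  obtain ⟨g, hg, rfl⟩ := h
  rw [← exp_eq_exp_iff_exists_int, exp_sub, exp_sub, exp_log, exp_log, hg, hg]
  all_goals rw [← hg]; exact exp_ne_zero _

/-- The relation between the logarithmic changes along the four sides of the square that
parametrizes the differences of points of two disjoint curves. -/
theorem exists_hasLogChange_of_disjoint {e f : unitInterval → ℂ} (he : Continuous e)
    (hf : Continuous f) (h : ∀ s t, e s ≠ f t) :
    ∃ δ₀ δ₁ ε₀ ε₁ : ℂ, HasLogChange (fun s ↦ e s - f 0) δ₀ ∧ HasLogChange (fun s ↦ e s - f 1) δ₁ ∧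
      HasLogChange (fun t ↦ f t - e 0) ε₀ ∧ HasLogChange (fun t ↦ f t - e 1) ε₁ ∧
      δ₀ + ε₁ = ε₀ + δ₁ := by
  obtain ⟨g, hg⟩ := exists_log_square (F := fun x ↦ e x.1 - f x.2) (by fun_prop)
    (fun x ↦ sub_ne_zero.2 (h _ _))
  refine ⟨g (1, 0) - g (0, 0), g (1, 1) - g (0, 1), g (0, 1) - g (0, 0), g (1, 1) - g (1, 0),
    ⟨⟨fun s ↦ g (s, 0), by fun_prop⟩, fun s ↦ hg _, rfl⟩,
    ⟨⟨fun s ↦ g (s, 1), by fun_prop⟩, fun s ↦ hg _, rfl⟩, ?_, ?_, by ring⟩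
  · simpa using HasLogChange.neg (f := fun t ↦ e 0 - f t) (δ := g (0, 1) - g (0, 0))
      ⟨⟨fun t ↦ g (0, t), by fun_prop⟩, fun t ↦ hg _, rfl⟩
  · simpa using HasLogChange.neg (f := fun t ↦ e 1 - f t) (δ := g (1, 1) - g (1, 0))
      ⟨⟨fun t ↦ g (1, t), by fun_prop⟩, fun t ↦ hg _, rfl⟩

/-- The difference of the principal logarithms of `y - x` and `x - y` is an odd multiple
of `π * I`. -/
theorem exists_log_sub_comm (x y : ℂ) (h : x ≠ y) :
    ∃ s : ℤ, log (y - x) - log (x - y) = (2 * s + 1) * (Real.pi * I) := by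
  have : exp (log (y - x)) = exp (log (x - y) + Real.pi * I) := by
    rw [exp_add, exp_log (sub_ne_zero.2 h.symm), exp_log (sub_ne_zero.2 h), exp_pi_mul_I]
    ring
  obtain ⟨n, hn⟩ := exp_eq_exp_iff_exists_int.1 this
  exact ⟨n, by rw [hn]; ring⟩

/-! ### The weak nonplanarity of the complete bipartite graph -/

/-- `K₃,₃` cannot be drawn in the plane by continuous curves in such a way that disjoint edges
are drawn disjointly: adjacent edges may cross, and edges may cross themselves.

Measured in units of `π * I`, the relation of each of the 18 squares of disjoint edges becomes a
relation between integers, and the sum of these relations fails modulo `4`. -/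
theorem not_exists_drawing_completeBipartite (p q : Fin 3 → ℂ) (γ : ∀ i j, Path (p i) (q j))
    (h : ∀ i j i' j', i ≠ i' → j ≠ j' → ∀ s t, γ i j s ≠ γ i' j' t) : False := by
  have other : ∀ i : Fin 3, ∃ j, i ≠ j := by decide
  have hp : ∀ i i', i ≠ i' → p i ≠ p i' := fun i i' hi ↦ by
    simpa using h i 0 i' 1 hi (by decide) 0 0
  have hq : ∀ j j', j ≠ j' → q j ≠ q j' := fun j j' hj ↦ by
    simpa using h 0 j 1 j' (by decide) hj 1 1
  have hpq : ∀ i j, p i ≠ q j := fun i j ↦ by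
    obtain ⟨i', hi⟩ := other i
    obtain ⟨j', hj⟩ := other j
    simpa using h i j' i' j hi hj.symm 0 1
  have hP : ∀ i' i j, ∃ δ, i ≠ i' → HasLogChange (fun t ↦ γ i j t - p i') δ := fun i' i j ↦ by
    by_cases hi : i = i'
    · exact ⟨0, fun h ↦ (h hi).elim⟩
    obtain ⟨j', hj⟩ := other j
    obtain ⟨δ, -, -, -, hδ, -⟩ := exists_hasLogChange_of_disjoint (γ i j).continuous
      (γ i' j').continuous (h i j i' j' hi hj)
    exact ⟨δ, fun _ ↦ by simpa using hδ⟩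
  have hQ : ∀ j' i j, ∃ δ, j ≠ j' → HasLogChange (fun t ↦ γ i j t - q j') δ := fun j' i j ↦ by
    by_cases hj : j = j'
    · exact ⟨0, fun h ↦ (h hj).elim⟩
    obtain ⟨i', hi⟩ := other i
    obtain ⟨-, δ, -, -, -, hδ, -⟩ := exists_hasLogChange_of_disjoint (γ i j).continuous
      (γ i' j').continuous (h i j i' j' hi hj)
    exact ⟨δ, fun _ ↦ by simpa using hδ⟩
  -- `δP i' i j` and `δQ j' i j`: logarithmic change of the edge `i j` seen from another vertex
  choose δP hδP using hP
  choose δQ hδQ using hQ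
  have hkP : ∀ i' i j, ∃ k : ℤ, i ≠ i' →
      δP i' i j = log (q j - p i') - log (p i - p i') + k * (2 * Real.pi * I) := fun i' i j ↦ by
    by_cases hi : i = i'
    · exact ⟨0, fun h ↦ (h hi).elim⟩
    obtain ⟨k, hk⟩ := (hδP i' i j hi).exists_int
    exact ⟨k, fun _ ↦ by simpa using hk⟩
  have hkQ : ∀ j' i j, ∃ k : ℤ, j ≠ j' →
      δQ j' i j = log (q j - q j') - log (p i - q j') + k * (2 * Real.pi * I) := fun j' i j ↦ by
    by_cases hj : j = j'
    · exact ⟨0, fun h ↦ (h hj).elim⟩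
    obtain ⟨k, hk⟩ := (hδQ j' i j hj).exists_int
    exact ⟨k, fun _ ↦ by simpa using hk⟩
  -- the excess of these changes over the differences of principal logarithms
  choose kP hkP using hkP
  choose kQ hkQ using hkQ
  have hsP : ∀ i i', ∃ s : ℤ, i ≠ i' →
      log (p i' - p i) - log (p i - p i') = (2 * s + 1) * (Real.pi * I) := fun i i' ↦ by
    by_cases hi : i = i'
    · exact ⟨0, fun h ↦ (h hi).elim⟩
    obtain ⟨s, hs⟩ := exists_log_sub_comm _ _ (hp i i' hi)
    exact ⟨s, fun _ ↦ hs⟩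
  have hsQ : ∀ j j', ∃ s : ℤ, j ≠ j' →
      log (q j' - q j) - log (q j - q j') = (2 * s + 1) * (Real.pi * I) := fun j j' ↦ by
    by_cases hj : j = j'
    · exact ⟨0, fun h ↦ (h hj).elim⟩
    obtain ⟨s, hs⟩ := exists_log_sub_comm _ _ (hq j j' hj)
    exact ⟨s, fun _ ↦ hs⟩
  choose sP hsP using hsP
  choose sQ hsQ using hsQ
  choose w hw using fun i j ↦ exists_log_sub_comm _ _ (hpq i j)
  have hne : (Real.pi * I : ℂ) ≠ 0 := by simp [Real.pi_ne_zero]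
  have hsQ' : ∀ j j', j ≠ j' → sQ j j' + sQ j' j + 1 = 0 := fun j j' hj ↦ by
    have h1 := hsQ j j' hj
    have h2 := hsQ j' j hj.symm
    have : (Real.pi * I : ℂ) * ((sQ j j' + sQ j' j + 1 : ℤ) : ℂ) = 0 := by
      push_cast
      linear_combination (-h1 - h2) / 2
    exact_mod_cast (mul_eq_zero.1 this).resolve_left hne
  -- the relation of the four sides of a square, divided by `π * I`
  have key : ∀ i i' j j', i ≠ i' → j ≠ j' →
      (2 * sQ j j' + 1) + (2 * sP i i' + 1) - (2 * w i j' + 1) + (2 * w i' j + 1) +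
        2 * (kP i' i j - kQ j' i j + kQ j i' j' - kP i i' j') = 0 := by
    intro i i' j j' hi hj
    obtain ⟨δ₀, δ₁, ε₀, ε₁, h₁, h₂, h₃, h₄, hsum⟩ := exists_hasLogChange_of_disjoint
      (γ i j).continuous (γ i' j').continuous (h i j i' j' hi hj)
    simp only [Path.source, Path.target] at h₁ h₂ h₃ h₄
    rw [h₁.unique (hδP i' i j hi), h₂.unique (hδQ j' i j hj),
      h₃.unique (hδP i i' j' hi.symm), h₄.unique (hδQ j i' j' hj.symm),
      hkP _ _ _ hi, hkP _ _ _ hi.symm, hkQ _ _ _ hj, hkQ _ _ _ hj.symm] at hsum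
    have h1 := hsQ j j' hj
    have h2 := hsP i i' hi
    have h3 := hw i j'
    have h4 := hw i' j
    have : (Real.pi * I : ℂ) * (((2 * sQ j j' + 1) + (2 * sP i i' + 1) - (2 * w i j' + 1)
        + (2 * w i' j + 1) +
        2 * (kP i' i j - kQ j' i j + kQ j i' j' - kP i i' j') : ℤ) : ℂ) = 0 := by
      push_cast
      linear_combination hsum - h1 - h2 + h3 - h4
    exact_mod_cast (mul_eq_zero.1 this).resolve_left hne
  have e := fun i i' (hi : i ≠ i') ↦
    And.intro (key i i' 0 1 hi (by decide)) <| And.intro (key i i' 1 0 hi (by decide)) <|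
    And.intro (key i i' 0 2 hi (by decide)) <| And.intro (key i i' 2 0 hi (by decide)) <|
    And.intro (key i i' 1 2 hi (by decide)) (key i i' 2 1 hi (by decide))
  obtain ⟨a1, a2, a3, a4, a5, a6⟩ := e 0 1 (by decide)
  obtain ⟨b1, b2, b3, b4, b5, b6⟩ := e 0 2 (by decide)
  obtain ⟨c1, c2, c3, c4, c5, c6⟩ := e 1 2 (by decide)
  have s1 := hsQ' 0 1 (by decide)
  have s2 := hsQ' 0 2 (by decide)
  have s3 := hsQ' 1 2 (by decide)
  -- in the sum of the 18 relations each excess occurs twice up to sign, the terms of `sQ` cancel,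
  -- those of `w` add up to a multiple of `4`, and those of `sP` to `6` times an odd number
  clear * - a1 a2 a3 a4 a5 a6 b1 b2 b3 b4 b5 b6 c1 c2 c3 c4 c5 c6 s1 s2 s3
  omega

/-! ### Nonplanarity of graphs that contain a subdivision of the bipartite graph -/

namespace SimpleGraph

variable {V : Type*} {G : SimpleGraph V}

/-- The part of the plane covered by the drawing of the subgraph induced on `S`. -/
def PlaneEmbedding.region (φ : G.PlaneEmbedding) (S : Set V) : Set ℂ :=
  φ.pt '' S ∪ ⋃ e : G.edgeSet, ⋃ _ : ∀ v ∈ (e : Sym2 V), v ∈ S, Set.range (φ.arc e)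

theorem PlaneEmbedding.mem_region (φ : G.PlaneEmbedding) {S : Set V} {z : ℂ} :
    z ∈ φ.region S ↔ (∃ v ∈ S, φ.pt v = z) ∨
      ∃ e : G.edgeSet, (∀ v ∈ (e : Sym2 V), v ∈ S) ∧ z ∈ Set.range (φ.arc e) := by
  simp [region]

theorem PlaneEmbedding.region_mono (φ : G.PlaneEmbedding) {S T : Set V} (h : S ⊆ T) :
    φ.region S ⊆ φ.region T := by
  intro z hz
  rw [mem_region] at hz ⊢
  rcases hz with ⟨v, hv, hz⟩ | ⟨e, he, hz⟩
  · exact .inl ⟨v, h hv, hz⟩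
  · exact .inr ⟨e, fun v hv ↦ h (he v hv), hz⟩

/-- Disjoint sets of vertices cover disjoint parts of the plane: two edges without a common end
are drawn disjointly. -/
theorem PlaneEmbedding.disjoint_region (φ : G.PlaneEmbedding) {S T : Set V} (h : Disjoint S T) :
    Disjoint (φ.region S) (φ.region T) := by
  rw [Set.disjoint_left] at h ⊢
  intro z hS hT
  rw [mem_region] at hS hT
  rcases hS with ⟨v, hv, rfl⟩ | ⟨e, he, hz⟩
  · rcases hT with ⟨w, hw, hvw⟩ | ⟨f, hf, hz⟩
    · exact h hv (φ.pt_injective hvw ▸ hw)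
    · exact h hv (hf _ (φ.mem_of_pt_mem_arc _ _ hz))
  · rcases hT with ⟨w, hw, rfl⟩ | ⟨f, hf, hz'⟩
    · exact h (he _ (φ.mem_of_pt_mem_arc _ _ hz)) hw
    · by_cases hef : e = f
      · subst hef
        obtain ⟨⟨a, b⟩, hab⟩ := e
        exact h (he a (Sym2.mem_mk_left a b)) (hf a (Sym2.mem_mk_left a b))
      · obtain ⟨v, rfl⟩ := φ.arc_inter_arc e f hef ⟨hz, hz'⟩
        exact h (he _ (φ.mem_of_pt_mem_arc _ _ hz)) (hf _ (φ.mem_of_pt_mem_arc _ _ hz'))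

theorem PlaneEmbedding.exists_path_of_adj (φ : G.PlaneEmbedding) {u v : V} (h : G.Adj u v) :
    ∃ γ : _root_.Path (φ.pt u) (φ.pt v), ∀ t, γ t ∈ φ.region {u, v} := by
  have key : ∀ t, φ.arc ⟨s(u, v), h⟩ t ∈ φ.region {u, v} := fun t ↦
    φ.mem_region.2 (.inr ⟨⟨s(u, v), h⟩, by simp, t, rfl⟩)
  have hends := φ.arc_ends ⟨s(u, v), h⟩
  rw [Sym2.map_mk, Sym2.eq_iff] at hends
  rcases hends with ⟨h0, h1⟩ | ⟨h0, h1⟩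
  · exact ⟨⟨φ.arc ⟨s(u, v), h⟩, h0, h1⟩, key⟩
  · exact ⟨(⟨φ.arc ⟨s(u, v), h⟩, h0, h1⟩ : _root_.Path _ _).symm, fun t ↦ key _⟩

/-- A walk is drawn as a curve that stays in the part of the plane covered by its vertices. -/
theorem PlaneEmbedding.exists_path_of_walk (φ : G.PlaneEmbedding) {u v : V} (w : G.Walk u v) :
    ∃ γ : _root_.Path (φ.pt u) (φ.pt v), ∀ t, γ t ∈ φ.region {x | x ∈ w.support} := by
  induction w with
  | nil => exact ⟨_root_.Path.refl _, fun t ↦ φ.mem_region.2 (.inl ⟨_, by simp, rfl⟩)⟩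
  | @cons u v _ h w ih =>
    obtain ⟨γ, hγ⟩ := φ.exists_path_of_adj h
    obtain ⟨γ', hγ'⟩ := ih
    refine ⟨γ.trans γ', fun t ↦ ?_⟩
    have ht : γ.trans γ' t ∈ Set.range γ ∪ Set.range γ' := by
      rw [← _root_.Path.trans_range]
      exact ⟨t, rfl⟩
    rcases ht with ⟨s, hs⟩ | ⟨s, hs⟩
    · rw [← hs]
      refine φ.region_mono ?_ (hγ s)
      rintro x (rfl | rfl) <;> simp
    · rw [← hs]
      exact φ.region_mono (fun x hx ↦ by simp at hx ⊢; exact .inr hx) (hγ' s)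

/-- A graph that contains a subdivision of `K₃,₃` with at most one subdivided edge is
not planar. -/
theorem not_isPlanar_of_walk {a₀ a₁ a₂ b₀ b₁ b₂ : V} (hnd : [a₀, a₁, a₂, b₀, b₁, b₂].Nodup)
    (w : G.Walk a₀ b₀) (hw : ∀ x ∈ w.support, x ≠ a₁ ∧ x ≠ a₂ ∧ x ≠ b₁ ∧ x ≠ b₂)
    (h01 : G.Adj a₀ b₁) (h02 : G.Adj a₀ b₂) (h10 : G.Adj a₁ b₀) (h11 : G.Adj a₁ b₁)
    (h12 : G.Adj a₁ b₂) (h20 : G.Adj a₂ b₀) (h21 : G.Adj a₂ b₁) (h22 : G.Adj a₂ b₂) :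
    ¬ G.IsPlanar := by
  rintro ⟨φ⟩
  let a : Fin 3 → V := ![a₀, a₁, a₂]
  let b : Fin 3 → V := ![b₀, b₁, b₂]
  simp only [List.nodup_cons, List.mem_cons, List.not_mem_nil, or_false, not_or] at hnd
  obtain ⟨⟨n1, n2, n3, n4, n5⟩, ⟨n6, n7, n8, n9⟩, ⟨n10, n11, n12⟩, ⟨n13, n14⟩, n15, -⟩ := hnd
  have ha : ∀ i i', i ≠ i' → a i ≠ a i' := by
    intro i i' h
    fin_cases i <;> fin_cases i' <;>
      first | exact absurd rfl h | assumption | (apply Ne.symm; assumption)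
  have hb : ∀ i i', i ≠ i' → b i ≠ b i' := by
    intro i i' h
    fin_cases i <;> fin_cases i' <;>
      first | exact absurd rfl h | assumption | (apply Ne.symm; assumption)
  have hne : ∀ i j, a i ≠ b j := by
    intro i j
    fin_cases i <;> fin_cases j <;> assumption
  have hab : ∀ i j, ∃ S : Set V,
      (∃ γ : _root_.Path (φ.pt (a i)) (φ.pt (b j)), ∀ t, γ t ∈ φ.region S) ∧
      ∀ x ∈ S, x = a i ∨ x = b j ∨ (i = 0 ∧ j = 0 ∧ ∀ k, k ≠ 0 → x ≠ a k ∧ x ≠ b k) := by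
    intro i j
    by_cases hij : i = 0 ∧ j = 0
    · obtain ⟨rfl, rfl⟩ := hij
      refine ⟨_, φ.exists_path_of_walk w, fun x hx ↦ .inr (.inr ⟨rfl, rfl, fun k hk ↦ ?_⟩)⟩
      have := hw x hx
      fin_cases k <;> simp_all [a, b]
    · have hadj : G.Adj (a i) (b j) := by
        fin_cases i <;> fin_cases j <;> first | assumption | simp at hij
      exact ⟨_, φ.exists_path_of_adj hadj, fun x hx ↦ hx.imp_right .inl⟩
  choose S hγ hS using hab
  choose γ hγ using hγ
  refine not_exists_drawing_completeBipartite _ _ γ fun i j i' j' hi hj s t hst ↦ ?_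
  have hdisj : Disjoint (S i j) (S i' j') := by
    rw [Set.disjoint_left]
    intro x hx hx'
    rcases hS _ _ x hx with rfl | rfl | ⟨rfl, rfl, h⟩
    · rcases hS _ _ _ hx' with h' | h' | ⟨rfl, rfl, h'⟩
      · exact ha _ _ hi h'
      · exact hne _ _ h'
      · exact (h' i hi).1 rfl
    · rcases hS _ _ _ hx' with h' | h' | ⟨rfl, rfl, h'⟩
      · exact hne _ _ h'.symm
      · exact hb _ _ hj h'
      · exact (h' j hj).2 rfl
    · rcases hS _ _ _ hx' with h' | h' | ⟨rfl, rfl, h'⟩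
      · exact (h i' hi.symm).1 h'
      · exact (h j' hj.symm).2 h'
      · exact hi rfl
  exact Set.disjoint_left.1 (φ.disjoint_region hdisj) (hγ i j s) (hst ▸ hγ i' j' t)

/-! ### Transfer along maps of graphs -/

theorem IsPlanar.of_hom {W : Type*} {H : SimpleGraph W} (hH : H.IsPlanar) (f : G →g H)
    (hf : Function.Injective f) : G.IsPlanar := by
  obtain ⟨φ⟩ := hH
  have hinj : Function.Injective fun e : G.edgeSet ↦ f.mapEdgeSet e :=
    Hom.mapEdgeSet.injective f hf
  refine ⟨⟨φ.pt ∘ f, fun e ↦ φ.arc (f.mapEdgeSet e), φ.pt_injective.comp hf,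
    fun e ↦ φ.arc_injective _, fun e ↦ ?_, fun e v hv ↦ ?_, fun e e' hee' z hz ↦ ?_⟩⟩
  · rw [φ.arc_ends, ← Sym2.map_map]
    rfl
  · have := φ.mem_of_pt_mem_arc _ _ hv
    obtain ⟨w, hw, hwv⟩ := Sym2.mem_map.1 this
    exact hf hwv ▸ hw
  · obtain ⟨w, rfl⟩ := φ.arc_inter_arc _ _ (hinj.ne hee') hz
    have := φ.mem_of_pt_mem_arc _ _ hz.1
    obtain ⟨v, -, rfl⟩ := Sym2.mem_map.1 this
    exact ⟨v, rfl⟩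

/-- The three properties depend only on the isomorphism type of the graph. -/
theorem exists_of_card_eq {W : Type*} [Fintype W] [DecidableEq W] {n : ℕ}
    (hW : Fintype.card W = n)
    {G : SimpleGraph W} (hG : G.IsHamiltonian ∧ G.IsMaximalPlanar ∧ G.IsTriangleDecomposable) :
    ∃ H : SimpleGraph (Fin n),
      H.IsHamiltonian ∧ H.IsMaximalPlanar ∧ H.IsTriangleDecomposable := by
  obtain ⟨h1, ⟨h2, h3⟩, P, hP, hdisj, hun⟩ := hG
  let e : Fin n ≃ W := (Fintype.equivFinOfCardEq hW).symm
  let i : G.comap e ≃g G := Iso.comap e G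
  refine ⟨G.comap e, fun hn ↦ ?_, ⟨h2.of_hom i.toHom i.injective, fun u v huv hadj hpl ↦ ?_⟩,
    (fun T ↦ Sym2.map e ⁻¹' T) '' P, ?_, ?_, ?_⟩
  · obtain ⟨a, p, hp⟩ := h1 (by rwa [hW, ← Fintype.card_fin n])
    exact ⟨_, p.map i.symm.toHom, hp.map i.symm.bijective⟩
  · refine h3 (e u) (e v) (e.injective.ne huv) hadj (hpl.of_hom ⟨e.symm, ?_⟩ e.symm.injective)
    intro x y hxy
    simp only [sup_adj, edge_adj, comap_adj, Equiv.apply_symm_apply, e.symm_apply_eq] at hxy ⊢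
    simpa using hxy
  · rintro _ ⟨T, hT, rfl⟩
    obtain ⟨a, b, c, hab, hac, hbc, rfl⟩ := hP T hT
    refine ⟨e.symm a, e.symm b, e.symm c, by simpa, by simpa, by simpa, ?_⟩
    ext x
    have : ∀ a b, Sym2.map e x = s(a, b) ↔ x = s(e.symm a, e.symm b) := by
      intro a b
      induction x with | _ x y
      simp [Equiv.eq_symm_apply]
    simp [this]
  · rintro _ ⟨T, hT, rfl⟩ _ ⟨T', hT', rfl⟩ hne
    exact (hdisj hT hT' fun h ↦ hne (by rw [h])).preimage _
  · ext x
    have : x ∈ (G.comap e).edgeSet ↔ Sym2.map e x ∈ G.edgeSet := by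
      induction x with | _ x y
      simp
    rw [this, ← hun]
    simp

end SimpleGraph

/-! ### Drawings by segments and parabolic arcs -/

namespace SimpleGraph

/-- A drawing of the edges of `fromRel r`, given for each edge in the direction chosen by `r`, is a
plane embedding as soon as two distinct edges meet only in common ends. -/
theorem isPlanar_fromRel_of_drawing {V : Type*} {r : V → V → Prop} (hr : ∀ v, ¬ r v v)
    (hiso : ∀ v, ∃ w, r v w ∨ r w v) {pt : V → ℂ} (hpt : Function.Injective pt)
    (γ : V → V → C(unitInterval, ℂ)) (h0 : ∀ a b, r a b → γ a b 0 = pt a)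
    (h1 : ∀ a b, r a b → γ a b 1 = pt b)
    (hinj : ∀ a b, r a b → Function.Injective (γ a b))
    (hcross : ∀ a b c d, r a b → r c d → s(a, b) ≠ s(c, d) → ∀ s t, γ a b s = γ c d t →
      ∃ v, v ∈ s(a, b) ∧ v ∈ s(c, d) ∧ γ a b s = pt v) :
    (fromRel r).IsPlanar := by
  have hdir : ∀ e : (fromRel r).edgeSet, ∃ x : V × V, r x.1 x.2 ∧ (e : Sym2 V) = s(x.1, x.2) := by
    rintro ⟨⟨a, b⟩, h⟩
    obtain ⟨-, h | h⟩ := (fromRel_adj r a b).1 h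
    · exact ⟨(a, b), h, rfl⟩
    · exact ⟨(b, a), h, Sym2.eq_swap⟩
  choose x hx hxe using hdir
  have key : ∀ e f, e ≠ f → ∀ s t, γ (x e).1 (x e).2 s = γ (x f).1 (x f).2 t →
      ∃ v, v ∈ (e : Sym2 V) ∧ v ∈ (f : Sym2 V) ∧ γ (x e).1 (x e).2 s = pt v := by
    intro e f hef s t hst
    rw [hxe e, hxe f]
    exact hcross _ _ _ _ (hx e) (hx f)
      (fun h ↦ hef (Subtype.ext ((hxe e).trans (h.trans (hxe f).symm)))) s t hst
  refine ⟨⟨pt, fun e ↦ γ (x e).1 (x e).2, hpt, fun e ↦ hinj _ _ (hx e), fun e ↦ ?_, ?_, ?_⟩⟩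
  · rw [h0 _ _ (hx e), h1 _ _ (hx e), hxe e, Sym2.map_mk]
  · rintro e v ⟨s, hs⟩
    obtain ⟨w, hw⟩ := hiso v
    have hvw : (fromRel r).Adj v w := by
      refine (fromRel_adj r v w).2 ⟨?_, hw⟩
      rintro rfl
      exact hr v (hw.elim id id)
    by_cases hef : e = ⟨s(v, w), hvw⟩
    · rw [hef]
      exact Sym2.mem_mk_left v w
    · have hv : v ∈ s((x ⟨s(v, w), hvw⟩).1, (x ⟨s(v, w), hvw⟩).2) := by
        rw [← hxe]
        exact Sym2.mem_mk_left v w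
      -- the point of `v` is an end of the arc of `s(v, w)`, hence common to two arcs
      have hend : ∃ t, pt v = γ (x ⟨s(v, w), hvw⟩).1 (x ⟨s(v, w), hvw⟩).2 t := by
        rcases Sym2.mem_iff.1 hv with h | h
        · exact ⟨0, by rw [h0 _ _ (hx _), ← h]⟩
        · exact ⟨1, by rw [h1 _ _ (hx _), ← h]⟩
      obtain ⟨t, ht⟩ := hend
      obtain ⟨u, hu, -, hu'⟩ := key e _ hef s t (hs.trans ht)
      rwa [hpt (hs.symm.trans hu')]
  · rintro e f hef z ⟨⟨s, rfl⟩, t, ht⟩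
    obtain ⟨u, -, -, hu⟩ := key e f hef s t ht.symm
    exact ⟨u, hu.symm⟩

end SimpleGraph

/-- The point of the plane with the given integer coordinates. -/
def latticePoint (p : ℤ × ℤ) : ℂ := ⟨p.1, p.2⟩

theorem latticePoint_injective : Function.Injective latticePoint := by
  intro p q h
  have h1 := congrArg Complex.re h
  have h2 := congrArg Complex.im h
  simp only [latticePoint, Int.cast_inj] at h1 h2
  exact Prod.ext h1 h2

/-- The parabolic arc from `p` to `q` whose horizontal deviation from the segment is
`c * t * (1 - t)`; it is the segment itself if `c = 0`. -/
def bentArc (p q : ℤ × ℤ) (c : ℤ) : C(unitInterval, ℂ) where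
  toFun t := latticePoint p + (t : ℝ) * (latticePoint q - latticePoint p) +
    c * (t : ℝ) * (1 - (t : ℝ))

theorem bentArc_re (p q : ℤ × ℤ) (c : ℤ) (t : unitInterval) :
    (bentArc p q c t).re = (1 - t) * p.1 + t * q.1 + c * (t * (1 - t)) := by
  have : (c * (t : ℝ) * (1 - (t : ℝ)) : ℂ) = ((c * (t * (1 - t)) : ℝ) : ℂ) := by
    push_cast; ring
  simp only [bentArc, ContinuousMap.coe_mk, this, Complex.add_re, Complex.ofReal_re,
    Complex.re_ofReal_mul, Complex.sub_re, latticePoint]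
  ring

theorem bentArc_im (p q : ℤ × ℤ) (c : ℤ) (t : unitInterval) :
    (bentArc p q c t).im = (1 - t) * p.2 + t * q.2 := by
  have : (c * (t : ℝ) * (1 - (t : ℝ)) : ℂ) = ((c * (t * (1 - t)) : ℝ) : ℂ) := by
    push_cast; ring
  simp only [bentArc, ContinuousMap.coe_mk, this, Complex.add_im, Complex.ofReal_im,
    Complex.im_ofReal_mul, Complex.sub_im, latticePoint]
  ring

theorem bentArc_zero (p q : ℤ × ℤ) (c : ℤ) : bentArc p q c 0 = latticePoint p := by
  simp [bentArc]

theorem bentArc_one (p q : ℤ × ℤ) (c : ℤ) : bentArc p q c 1 = latticePoint q := by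
  simp [bentArc]

theorem bentArc_injective {p q : ℤ × ℤ} {c : ℤ} (hpq : p ≠ q) (h : c = 0 ∨ p.2 ≠ q.2) :
    Function.Injective (bentArc p q c) := by
  intro s t hst
  have h1 := congrArg Complex.re hst
  have h2 := congrArg Complex.im hst
  rw [bentArc_re, bentArc_re] at h1
  rw [bentArc_im, bentArc_im] at h2
  by_cases h' : p.2 = q.2
  · rcases h with rfl | h
    · have hne : (q.1 - p.1 : ℝ) ≠ 0 :=
        sub_ne_zero.2 fun h ↦ hpq (Prod.ext (by exact_mod_cast h.symm) h')
      exact Subtype.ext (mul_right_cancel₀ hne (by push_cast at h1; linarith))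
    · exact absurd h' h
  · have hne : (q.2 - p.2 : ℝ) ≠ 0 := sub_ne_zero.2 fun h ↦ h' (by exact_mod_cast h.symm)
    exact Subtype.ext (mul_right_cancel₀ hne (by linarith))

/-- The line `α x + β y + γ = 0` has the segment from `p` to `q` on one side and the segment from
`p'` to `q'` on the other; the point `p` is not on the line, and the last clause excludes that
`q` is an inner point of the segment from `p'` to `q'`. -/
def LineSeparates (α β γ : ℤ) (p q p' q' : ℤ × ℤ) : Prop :=
  α * p.1 + β * p.2 + γ < 0 ∧ α * q.1 + β * q.2 + γ ≤ 0 ∧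
    0 ≤ α * p'.1 + β * p'.2 + γ ∧ 0 ≤ α * q'.1 + β * q'.2 + γ ∧
    (α * q.1 + β * q.2 + γ < 0 ∨ (q.1 = p'.1 ∧ q.2 = p'.2) ∨ (q.1 = q'.1 ∧ q.2 = q'.2) ∨
      0 < α * p'.1 + β * p'.2 + γ ∨ 0 < α * q'.1 + β * q'.2 + γ)

instance (α β γ : ℤ) (p q p' q' : ℤ × ℤ) : Decidable (LineSeparates α β γ p q p' q') := by
  unfold LineSeparates
  infer_instance

/-- Every common point of the two segments is an end of both. -/
def SegmentsMeetInEnds (p q p' q' : ℤ × ℤ) : Prop :=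
  ∀ s t, bentArc p q 0 s = bentArc p' q' 0 t →
    ∃ x, (x = p ∨ x = q) ∧ (x = p' ∨ x = q') ∧ bentArc p q 0 s = latticePoint x

theorem SegmentsMeetInEnds.symm {p q p' q' : ℤ × ℤ} (h : SegmentsMeetInEnds p q p' q') :
    SegmentsMeetInEnds p' q' p q := fun s t hst ↦ by
  obtain ⟨x, h1, h2, h3⟩ := h t s hst.symm
  exact ⟨x, h2, h1, hst.trans h3⟩

theorem SegmentsMeetInEnds.swap {p q p' q' : ℤ × ℤ} (h : SegmentsMeetInEnds p q p' q') :
    SegmentsMeetInEnds q p p' q' := fun s t hst ↦ by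
  have hs : bentArc q p 0 s = bentArc p q 0 (unitInterval.symm s) := by
    apply Complex.ext
    · simp only [bentArc_re, unitInterval.coe_symm_eq]; push_cast; ring
    · simp only [bentArc_im, unitInterval.coe_symm_eq]; ring
  obtain ⟨x, h1, h2, h3⟩ := h (unitInterval.symm s) t (hs ▸ hst)
  exact ⟨x, h1.symm, h2, hs ▸ h3⟩

theorem LineSeparates.segmentsMeetInEnds {α β γ : ℤ} {p q p' q' : ℤ × ℤ}
    (h : LineSeparates α β γ p q p' q') :
    SegmentsMeetInEnds p q p' q' := by
  intro s t hst
  obtain ⟨h1, h2, h3, h4, h5⟩ := h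
  have hx := congrArg Complex.re hst
  have hy := congrArg Complex.im hst
  simp only [bentArc_re, bentArc_im, Int.cast_zero, zero_mul, add_zero] at hx hy
  have h1' : (α * p.1 + β * p.2 + γ : ℝ) < 0 := by exact_mod_cast h1
  have h2' : (α * q.1 + β * q.2 + γ : ℝ) ≤ 0 := by exact_mod_cast h2
  have h3' : (0 : ℝ) ≤ α * p'.1 + β * p'.2 + γ := by exact_mod_cast h3
  have h4' : (0 : ℝ) ≤ α * q'.1 + β * q'.2 + γ := by exact_mod_cast h4
  have hL : (1 - s) * (α * p.1 + β * p.2 + γ : ℝ) + s * (α * q.1 + β * q.2 + γ) =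
      (1 - t) * (α * p'.1 + β * p'.2 + γ) + t * (α * q'.1 + β * q'.2 + γ) := by
    linear_combination α * hx + β * hy
  have a1 := mul_nonneg (sub_nonneg.2 s.2.2) (neg_nonneg.2 h1'.le)
  have a2 := mul_nonneg s.2.1 (neg_nonneg.2 h2')
  have a3 := mul_nonneg (sub_nonneg.2 t.2.2) h3'
  have a4 := mul_nonneg t.2.1 h4'
  have b1 : (1 - s : ℝ) * (α * p.1 + β * p.2 + γ) = 0 := by linarith
  have hs : s = 1 := Subtype.ext (sub_eq_zero.1 ((mul_eq_zero.1 b1).resolve_right h1'.ne)).symm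
  subst hs
  rw [bentArc_one] at hst ⊢
  refine ⟨q, .inr rfl, ?_, rfl⟩
  rcases h5 with h5 | h5 | h5 | h5 | h5
  · have h5' : (α * q.1 + β * q.2 + γ : ℝ) < 0 := by exact_mod_cast h5
    have : ((1 : unitInterval) : ℝ) = 1 := rfl
    rw [this] at a2 hL
    linarith
  · exact .inl (Prod.ext h5.1 h5.2)
  · exact .inr (Prod.ext h5.1 h5.2)
  · have h5' : (0 : ℝ) < α * p'.1 + β * p'.2 + γ := by exact_mod_cast h5
    have b3 : (1 - t : ℝ) * (α * p'.1 + β * p'.2 + γ) = 0 := by linarith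
    have ht : t = 1 := Subtype.ext (sub_eq_zero.1 ((mul_eq_zero.1 b3).resolve_right h5'.ne')).symm
    rw [ht, bentArc_one] at hst
    exact .inr (latticePoint_injective hst)
  · have h5' : (0 : ℝ) < α * q'.1 + β * q'.2 + γ := by exact_mod_cast h5
    have b4 : (t : ℝ) * (α * q'.1 + β * q'.2 + γ) = 0 := by linarith
    have ht : t = 0 := Subtype.ext ((mul_eq_zero.1 b4).resolve_right h5'.ne')
    rw [ht, bentArc_zero] at hst
    exact .inl (latticePoint_injective hst)

/-- The parabola `x + y (Y - y) = 0` bounds the convex region `0 ≤ x + y (Y - y)`, so it meets a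
segment of that region at most in ends of the segment, unless both ends lie on it. -/
theorem eq_zero_or_eq_one_of_parabola {p q : ℤ × ℤ} {Y : ℤ} (hp : 0 ≤ p.1 + p.2 * (Y - p.2))
    (hq : 0 ≤ q.1 + q.2 * (Y - q.2))
    (hpq : 0 < p.1 + p.2 * (Y - p.2) ∨ 0 < q.1 + q.2 * (Y - q.2)) {s t : unitInterval}
    (h : bentArc (0, 0) (0, Y) (-Y ^ 2) s = bentArc p q 0 t) : t = 0 ∨ t = 1 := by
  have hx := congrArg Complex.re h
  have hy := congrArg Complex.im h
  simp only [bentArc_re, bentArc_im] at hx hy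
  push_cast at hx hy
  have hp' : (0 : ℝ) ≤ p.1 + p.2 * (Y - p.2) := by exact_mod_cast hp
  have hq' : (0 : ℝ) ≤ q.1 + q.2 * (Y - q.2) := by exact_mod_cast hq
  -- the concavity of `y (Y - y)`
  have hsum : (1 - t) * (p.1 + p.2 * (Y - p.2) : ℝ) + t * (q.1 + q.2 * (Y - q.2)) +
      t * (1 - t) * (p.2 - q.2) ^ 2 = 0 := by
    have hx' : (1 - t) * (p.1 : ℝ) + t * q.1 = -Y ^ 2 * (s * (1 - s)) := by linarith
    have hy' : (1 - t) * (p.2 : ℝ) + t * q.2 = s * Y := by linarith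
    linear_combination hx' + (Y - ((1 - t) * (p.2 : ℝ) + t * q.2) - s * Y) * hy'
  by_contra! hcon
  have ht0 : (0 : ℝ) < t := lt_of_le_of_ne t.2.1 fun h ↦ hcon.1 (Subtype.ext h.symm)
  have ht1 : (0 : ℝ) < 1 - t := sub_pos.2 (lt_of_le_of_ne t.2.2 fun h ↦ hcon.2 (Subtype.ext h))
  have c1 := mul_nonneg ht1.le hp'
  have c2 := mul_nonneg ht0.le hq'
  have c3 : (0 : ℝ) ≤ t * (1 - t) * (p.2 - q.2) ^ 2 := by positivity
  rcases hpq with h' | h'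
  · have h' : (0 : ℝ) < p.1 + p.2 * (Y - p.2) := by exact_mod_cast h'
    have := mul_pos ht1 h'
    linarith
  · have h' : (0 : ℝ) < q.1 + q.2 * (Y - q.2) := by exact_mod_cast h'
    have := mul_pos ht0 h'
    linarith

theorem eq_zero_of_mem_parabola {p : ℤ × ℤ} {Y : ℤ} {s : unitInterval}
    (h : bentArc (0, 0) (0, Y) (-Y ^ 2) s = latticePoint p) : p.1 + p.2 * (Y - p.2) = 0 := by
  have hx := congrArg Complex.re h
  have hy := congrArg Complex.im h
  simp only [bentArc_re, bentArc_im, latticePoint] at hx hy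
  push_cast at hx hy
  have : (p.1 + p.2 * (Y - p.2) : ℝ) = 0 := by
    rw [← hx, ← hy]
    ring
  exact_mod_cast this

/-! ### Bipyramids -/

open SimpleGraph

/-- The vertices of a bipyramid over an `m`-cycle with `k` further vertices. -/
inductive BipyramidVertex (m k : ℕ)
  | north
  | south
  | rim (i : Fin m)
  | inner (a : Fin k)
  deriving DecidableEq

namespace BipyramidVertex

variable {m k : ℕ}

/-- The vertices, sorted by kind. -/
def equivSum (m k : ℕ) : BipyramidVertex m k ≃ Bool ⊕ Fin m ⊕ Fin k where
  toFun
    | north => .inl true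
    | south => .inl false
    | rim i => .inr (.inl i)
    | inner a => .inr (.inr a)
  invFun
    | .inl true => north
    | .inl false => south
    | .inr (.inl i) => rim i
    | .inr (.inr a) => inner a
  left_inv v := by cases v <;> rfl
  right_inv := by rintro ((_ | _) | _ | _) <;> rfl

instance : Fintype (BipyramidVertex m k) := .ofEquiv _ (equivSum m k).symm

theorem card_eq (m k : ℕ) : Fintype.card (BipyramidVertex m k) = m + k + 2 := by
  rw [Fintype.card_congr (equivSum m k)]
  simp
  omega

/-- The edges of the bipyramid over the cycle `0, 1, …, m - 1` and of an octahedron placed into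
its face `north, 0, 1`, each in one direction. The inner vertices `0`, `1`, `2` of the octahedron
are opposite to `north`, `rim 0`, `rim 1` respectively. -/
inductive Arc (m k : ℕ) : BipyramidVertex m k → BipyramidVertex m k → Prop
  | north (i : Fin m) : Arc m k north (rim i)
  | south (i : Fin m) : Arc m k south (rim i)
  | step (i j : Fin m) (h : i.val + 1 = j.val) : Arc m k (rim i) (rim j)
  | closing (i j : Fin m) (hi : i.val = 0) (hj : j.val + 1 = m) : Arc m k (rim i) (rim j)
  | innerNorth (a : Fin k) (h : a.val = 1 ∨ a.val = 2) : Arc m k (inner a) north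
  | innerRim (a : Fin k) (i : Fin m)
      (h : a.val = 0 ∧ i.val = 0 ∨ a.val = 0 ∧ i.val = 1 ∨ a.val = 1 ∧ i.val = 1 ∨
        a.val = 2 ∧ i.val = 0) : Arc m k (inner a) (rim i)
  | inner (a b : Fin k) (h : a < b) : Arc m k (inner a) (inner b)

end BipyramidVertex

open BipyramidVertex

/-- The bipyramid over an `m`-cycle, for `k = 0`, or this bipyramid with an octahedron placed into
one face, for `k = 3`. -/
def bipyramid (m k : ℕ) : SimpleGraph (BipyramidVertex m k) :=
  fromRel (Arc m k)

namespace BipyramidVertex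

variable {m k : ℕ}

/-! ### A plane drawing of the bipyramid -/

/-- The position of a vertex in a drawing: the rim lies on the vertical axis, and the
inner vertices lie in the triangle of `north`, `rim 0` and `rim 1`. -/
def position : BipyramidVertex m k → ℤ × ℤ
  | north => (5, 0)
  | south => (-5, 5)
  | rim i => (0, 5 * i)
  | inner a => (if a.val = 0 then 1 else 2, if a.val = 2 then 1 else 2)

theorem position_injective (hk : k ≤ 3) : Function.Injective (position (m := m) (k := k)) := by
  rintro (_ | _ | i | a) (_ | _ | j | b) h <;>
    simp only [position, Prod.mk.injEq] at h <;>
    first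
      | rfl
      | exact congrArg rim (Fin.ext (by omega))
      | exact congrArg inner (Fin.ext (by split_ifs at h <;> omega))
      | (exfalso; omega)

theorem Arc.irrefl (hm : 2 ≤ m) (v : BipyramidVertex m k) : ¬ Arc m k v v := by
  intro h
  cases h <;> omega

/-- The nine edges inside the face `north, 0, 1`, as pairs of positions. -/
def faceSegments : List ((ℤ × ℤ) × (ℤ × ℤ)) :=
  [((1, 2), (0, 0)), ((1, 2), (0, 5)), ((2, 2), (0, 5)), ((2, 1), (0, 0)),
    ((2, 2), (5, 0)), ((2, 1), (5, 0)), ((1, 2), (2, 2)), ((1, 2), (2, 1)), ((2, 2), (2, 1))]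

/-- The segments of the drawing: all edges except the one that closes the rim. -/
inductive IsDrawnSegment : (ℤ × ℤ) × (ℤ × ℤ) → Prop
  | north (i : ℕ) : IsDrawnSegment ((5, 0), (0, 5 * i))
  | south (i : ℕ) : IsDrawnSegment ((-5, 5), (0, 5 * i))
  | step (i : ℕ) : IsDrawnSegment ((0, 5 * i), (0, 5 * (i + 1)))
  | face {e} (he : e ∈ faceSegments) : IsDrawnSegment e

theorem segmentsMeetInEnds_north_north {i j : ℕ} (h : i < j) :
    SegmentsMeetInEnds (5, 0) (0, 5 * i) (5, 0) (0, 5 * j) :=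
  (LineSeparates.segmentsMeetInEnds (α := j) (β := 1) (γ := -5 * j)
    (by dsimp only [LineSeparates]; omega)).swap

theorem segmentsMeetInEnds_south_south {i j : ℕ} (h : i < j) :
    SegmentsMeetInEnds (-5, 5) (0, 5 * i) (-5, 5) (0, 5 * j) :=
  (LineSeparates.segmentsMeetInEnds (α := 1 - j) (β := 1) (γ := -5 * j)
    (by dsimp only [LineSeparates]; omega)).swap

theorem segmentsMeetInEnds_south_north (i j : ℕ) :
    SegmentsMeetInEnds (-5, 5) (0, 5 * i) (5, 0) (0, 5 * j) :=
  LineSeparates.segmentsMeetInEnds (α := 1) (β := 0) (γ := 0)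
    (by dsimp only [LineSeparates]; omega)

theorem segmentsMeetInEnds_step_north (i j : ℕ) :
    SegmentsMeetInEnds (0, 5 * i) (0, 5 * (i + 1)) (5, 0) (0, 5 * j) := by
  by_cases h : i < j
  · exact LineSeparates.segmentsMeetInEnds (α := j) (β := 1) (γ := -5 * j)
      (by dsimp only [LineSeparates]; omega)
  · exact (LineSeparates.segmentsMeetInEnds (α := -j) (β := -1) (γ := 5 * j)
      (by dsimp only [LineSeparates]; omega)).swap

theorem segmentsMeetInEnds_step_south (i j : ℕ) :
    SegmentsMeetInEnds (0, 5 * i) (0, 5 * (i + 1)) (-5, 5) (0, 5 * j) := by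
  by_cases h : i < j
  · exact LineSeparates.segmentsMeetInEnds (α := 1 - j) (β := 1) (γ := -5 * j)
      (by dsimp only [LineSeparates]; omega)
  · exact (LineSeparates.segmentsMeetInEnds (α := j - 1) (β := -1) (γ := 5 * j)
      (by dsimp only [LineSeparates]; omega)).swap

theorem segmentsMeetInEnds_step_step {i j : ℕ} (h : i < j) :
    SegmentsMeetInEnds (0, 5 * i) (0, 5 * (i + 1)) (0, 5 * j) (0, 5 * (j + 1)) :=
  LineSeparates.segmentsMeetInEnds (α := 0) (β := 1) (γ := -5 * (i + 1))
    (by dsimp only [LineSeparates]; omega)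

theorem segmentsMeetInEnds_face_north {e : (ℤ × ℤ) × (ℤ × ℤ)} (he : e ∈ faceSegments) (i : ℕ) :
    SegmentsMeetInEnds e.1 e.2 (5, 0) (0, 5 * i) := by
  simp only [faceSegments, List.mem_cons, List.not_mem_nil, or_false] at he
  by_cases h : i = 0
  · refine LineSeparates.segmentsMeetInEnds (α := 0) (β := -1) (γ := 0) ?_
    rcases he with rfl | rfl | rfl | rfl | rfl | rfl | rfl | rfl | rfl <;>
      dsimp only [LineSeparates] <;> omega
  · refine LineSeparates.segmentsMeetInEnds (α := 1) (β := 1) (γ := -5) ?_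
    rcases he with rfl | rfl | rfl | rfl | rfl | rfl | rfl | rfl | rfl <;>
      dsimp only [LineSeparates] <;> omega

theorem segmentsMeetInEnds_face_south {e : (ℤ × ℤ) × (ℤ × ℤ)} (he : e ∈ faceSegments) (i : ℕ) :
    SegmentsMeetInEnds (-5, 5) (0, 5 * i) e.1 e.2 := by
  simp only [faceSegments, List.mem_cons, List.not_mem_nil, or_false] at he
  refine LineSeparates.segmentsMeetInEnds (α := 1) (β := 0) (γ := 0) ?_
  rcases he with rfl | rfl | rfl | rfl | rfl | rfl | rfl | rfl | rfl <;>
    dsimp only [LineSeparates] <;> omega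

theorem segmentsMeetInEnds_face_step {e : (ℤ × ℤ) × (ℤ × ℤ)} (he : e ∈ faceSegments) (i : ℕ) :
    SegmentsMeetInEnds e.1 e.2 (0, 5 * i) (0, 5 * (i + 1)) := by
  simp only [faceSegments, List.mem_cons, List.not_mem_nil, or_false] at he
  by_cases h : i = 0
  · refine LineSeparates.segmentsMeetInEnds (α := -1) (β := 0) (γ := 0) ?_
    rcases he with rfl | rfl | rfl | rfl | rfl | rfl | rfl | rfl | rfl <;>
      dsimp only [LineSeparates] <;> omega
  · refine LineSeparates.segmentsMeetInEnds (α := 1) (β := 1) (γ := -5) ?_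
    rcases he with rfl | rfl | rfl | rfl | rfl | rfl | rfl | rfl | rfl <;>
      dsimp only [LineSeparates] <;> omega

theorem segmentsMeetInEnds_face_face {e f : (ℤ × ℤ) × (ℤ × ℤ)} (he : e ∈ faceSegments)
    (hf : f ∈ faceSegments) (hef : e ≠ f) : SegmentsMeetInEnds e.1 e.2 f.1 f.2 := by
  -- the line through one of the two segments separates them
  let sep (p q p' q' : ℤ × ℤ) (σ : ℤ) : Prop := LineSeparates (σ * (p'.2 - q'.2))
    (σ * (q'.1 - p'.1)) (σ * (p'.1 * q'.2 - p'.2 * q'.1)) p q p' q'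
  have key : ∀ e ∈ faceSegments, ∀ f ∈ faceSegments, e ≠ f → ∃ σ ∈ [1, -1],
      sep e.1 e.2 f.1 f.2 σ ∨ sep e.2 e.1 f.1 f.2 σ ∨
      sep f.1 f.2 e.1 e.2 σ ∨ sep f.2 f.1 e.1 e.2 σ := by
    decide +kernel
  obtain ⟨σ, -, h | h | h | h⟩ := key e he f hf hef
  · exact h.segmentsMeetInEnds
  · exact h.segmentsMeetInEnds.swap
  · exact h.segmentsMeetInEnds.symm
  · exact h.segmentsMeetInEnds.swap.symm

theorem IsDrawnSegment.segmentsMeetInEnds {e f : (ℤ × ℤ) × (ℤ × ℤ)} (he : IsDrawnSegment e)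
    (hf : IsDrawnSegment f) (hef : e ≠ f) : SegmentsMeetInEnds e.1 e.2 f.1 f.2 := by
  rcases he with i | i | i | he <;> rcases hf with j | j | j | hf
  · rcases lt_trichotomy i j with h | rfl | h
    · exact segmentsMeetInEnds_north_north h
    · exact absurd rfl hef
    · exact (segmentsMeetInEnds_north_north h).symm
  · exact (segmentsMeetInEnds_south_north _ _).symm
  · exact (segmentsMeetInEnds_step_north _ _).symm
  · exact (segmentsMeetInEnds_face_north hf _).symm
  · exact segmentsMeetInEnds_south_north _ _
  · rcases lt_trichotomy i j with h | rfl | h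
    · exact segmentsMeetInEnds_south_south h
    · exact absurd rfl hef
    · exact (segmentsMeetInEnds_south_south h).symm
  · exact (segmentsMeetInEnds_step_south _ _).symm
  · exact segmentsMeetInEnds_face_south hf _
  · exact segmentsMeetInEnds_step_north _ _
  · exact segmentsMeetInEnds_step_south _ _
  · rcases lt_trichotomy i j with h | rfl | h
    · exact segmentsMeetInEnds_step_step h
    · exact absurd rfl hef
    · exact (segmentsMeetInEnds_step_step h).symm
  · exact (segmentsMeetInEnds_face_step hf _).symm
  · exact segmentsMeetInEnds_face_north he _
  · exact (segmentsMeetInEnds_face_south he _).symm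
  · exact segmentsMeetInEnds_face_step he _
  · exact segmentsMeetInEnds_face_face he hf hef

/-- The height of the last rim vertex. -/
def top (m : ℕ) : ℤ := 5 * (m - 1)

/-- The edge that closes the rim is drawn as an arc of a parabola that passes to the left of
everything else; all other edges are segments. -/
def bend : BipyramidVertex m k → BipyramidVertex m k → ℤ
  | rim i, rim j => if i.val = 0 ∧ j.val + 1 = m then -(top m) ^ 2 else 0
  | _, _ => 0

theorem bend_eq_zero_or (hm : 4 ≤ m) {a b : BipyramidVertex m 3} (h : Arc m 3 a b) :
    bend a b = 0 ∧ IsDrawnSegment (position a, position b) ∨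
      position a = (0, 0) ∧ position b = (0, top m) ∧ bend a b = -(top m) ^ 2 := by
  cases h with
  | north i => exact .inl ⟨rfl, .north i⟩
  | south i => exact .inl ⟨rfl, .south i⟩
  | step i j h =>
    refine .inl ⟨if_neg (by omega), ?_⟩
    have : position (k := 3) (rim j) = (0, 5 * ((i.val : ℤ) + 1)) := by
      simp [position, ← h]
    rw [this]
    exact .step i
  | closing i j hi hj =>
    refine .inr ⟨by simp [position, hi], ?_, if_pos ⟨hi, hj⟩⟩
    simp only [position, top, Prod.mk.injEq, true_and]
    omega
  | innerNorth a h =>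
    refine .inl ⟨rfl, .face ?_⟩
    rcases h with h | h <;> simp [position, h, faceSegments]
  | innerRim a i h =>
    refine .inl ⟨rfl, .face ?_⟩
    rcases h with ⟨h, h'⟩ | ⟨h, h'⟩ | ⟨h, h'⟩ | ⟨h, h'⟩ <;> simp [position, h, h', faceSegments]
  | inner a b h =>
    refine .inl ⟨rfl, .face ?_⟩
    fin_cases a <;> fin_cases b <;>
      first | (exfalso; revert h; decide) | simp [position, faceSegments]

/-- A vertex lies strictly to the right of the parabola unless it is an end of the parabolic
arc. -/
theorem parabola_pos_or (hm : 4 ≤ m) (v : BipyramidVertex m k) :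
    0 < (position v).1 + (position v).2 * (top m - (position v).2) ∨
      (position v).1 + (position v).2 * (top m - (position v).2) = 0 ∧
      (position v = (0, 0) ∨ position v = (0, top m)) := by
  cases v with
  | north => simp [position]
  | south => left; simp only [position, top]; omega
  | rim i =>
    by_cases hi : i.val = 0
    · right; simp [position, hi]
    by_cases hi' : i.val + 1 = m
    · have : (5 * i.val : ℤ) = top m := by simp only [top]; omega
      right; simp [position, this]
    · left
      simp only [position, zero_add]
      refine mul_pos (by omega) ?_
      simp only [top]
      omega
  | inner a =>
    left
    simp only [position, top]
    split_ifs <;> omega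

end BipyramidVertex

theorem bipyramid_three_isPlanar {m : ℕ} (hm : 4 ≤ m) : (bipyramid m 3).IsPlanar := by
  have hinj := position_injective (m := m) (k := 3) le_rfl
  have hirr := Arc.irrefl (m := m) (k := 3) (by omega)
  have hpar : ∀ a b c d : BipyramidVertex m 3, Arc m 3 a b → Arc m 3 c d → s(a, b) ≠ s(c, d) →
      position a = (0, 0) ∧ position b = (0, top m) ∧ bend a b = -(top m) ^ 2 →
      ∀ s t, bentArc (position a) (position b) (bend a b) s =
        bentArc (position c) (position d) (bend c d) t →
      ∃ v, v ∈ s(a, b) ∧ v ∈ s(c, d) ∧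
        bentArc (position a) (position b) (bend a b) s = latticePoint (position v) := by
    intro a b c d hab hcd hne ⟨ha, hb, hbend⟩ s t hst
    rcases bend_eq_zero_or hm hcd with ⟨hc, hseg⟩ | ⟨hc, hd, -⟩
    swap
    · exact absurd (by rw [hinj (ha.trans hc.symm), hinj (hb.trans hd.symm)]) hne
    have hend : ∀ v, bentArc (0, 0) (0, top m) (-(top m) ^ 2) s = latticePoint (position v) →
        v ∈ s(a, b) := by
      intro v hv
      rcases parabola_pos_or hm v with h | ⟨-, h | h⟩
      · exact absurd (eq_zero_of_mem_parabola hv) h.ne'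
      · exact Sym2.mem_iff.2 (.inl (hinj (h.trans ha.symm)))
      · exact Sym2.mem_iff.2 (.inr (hinj (h.trans hb.symm)))
    rw [ha, hb, hbend, hc] at hst
    rw [ha, hb, hbend]
    have ht : t = 0 ∨ t = 1 := by
      refine eq_zero_or_eq_one_of_parabola ?_ ?_ ?_ hst
      · rcases parabola_pos_or hm c with h | ⟨h, -⟩
        exacts [h.le, h.ge]
      · rcases parabola_pos_or hm d with h | ⟨h, -⟩
        exacts [h.le, h.ge]
      · rcases parabola_pos_or hm c with h | ⟨-, h⟩
        · exact .inl h
        rcases parabola_pos_or hm d with h' | ⟨-, h'⟩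
        · exact .inr h'
        -- a segment with both ends on the parabola joins the ends of the parabolic arc
        have hcd' : position c ≠ position d := fun h ↦ hirr c (by rwa [← hinj h] at hcd)
        rw [← ha, ← hb] at h h'
        rcases h with h | h <;> rcases h' with h' | h'
        · exact absurd (h.trans h'.symm) hcd'
        · exact absurd (by rw [hinj h, hinj h']) hne
        · exact absurd (by rw [hinj h, hinj h', Sym2.eq_swap]) hne
        · exact absurd (h.trans h'.symm) hcd'
    rcases ht with rfl | rfl
    · rw [bentArc_zero] at hst
      exact ⟨c, hend c hst, Sym2.mem_mk_left _ _, hst⟩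
    · rw [bentArc_one] at hst
      exact ⟨d, hend d hst, Sym2.mem_mk_right _ _, hst⟩
  refine isPlanar_fromRel_of_drawing hirr ?_ (latticePoint_injective.comp hinj)
    (fun a b ↦ bentArc (position a) (position b) (bend a b)) (fun a b _ ↦ bentArc_zero _ _ _)
    (fun a b _ ↦ bentArc_one _ _ _) (fun a b h ↦ ?_) ?_
  · have h0 : 0 < m := by omega
    rintro (_ | _ | i | a)
    · exact ⟨rim ⟨0, h0⟩, .inl (.north _)⟩
    · exact ⟨rim ⟨0, h0⟩, .inl (.south _)⟩
    · exact ⟨.north, .inr (.north _)⟩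
    · by_cases ha : a.val = 0
      · exact ⟨rim ⟨0, h0⟩, .inl (.innerRim _ _ (.inl ⟨ha, rfl⟩))⟩
      · exact ⟨.north, .inl (.innerNorth _ (by omega))⟩
  · refine bentArc_injective (fun h' ↦ hirr a (by rwa [← hinj h'] at h)) ?_
    rcases bend_eq_zero_or hm h with ⟨h, -⟩ | ⟨h, h', -⟩
    · exact .inl h
    · rw [h, h']
      refine .inr ?_
      simp only [top]
      omega
  · intro a b c d hab hcd hne s t hst
    rcases bend_eq_zero_or hm hab with ⟨ha, hseg⟩ | h
    · rcases bend_eq_zero_or hm hcd with ⟨hc, hseg'⟩ | h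
      · rw [ha, hc] at hst
        obtain ⟨x, hx, hx', hxs⟩ := hseg.segmentsMeetInEnds hseg' (fun h ↦ hne (by
          rw [hinj (congrArg Prod.fst h), hinj (congrArg Prod.snd h)])) s t hst
        rw [← ha] at hxs
        rcases hx with rfl | rfl
        · exact ⟨a, Sym2.mem_mk_left _ _,
            Sym2.mem_iff.2 (hx'.imp (fun h ↦ hinj h) fun h ↦ hinj h), hxs⟩
        · exact ⟨b, Sym2.mem_mk_right _ _,
            Sym2.mem_iff.2 (hx'.imp (fun h ↦ hinj h) fun h ↦ hinj h), hxs⟩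
      · obtain ⟨v, hv, hv', hvs⟩ := hpar c d a b hcd hab hne.symm h t s hst.symm
        exact ⟨v, hv', hv, hst.trans hvs⟩
    · exact hpar a b c d hab hcd hne h s t hst

theorem bipyramid_zero_isPlanar {m : ℕ} (hm : 4 ≤ m) : (bipyramid m 0).IsPlanar := by
  let f : BipyramidVertex m 0 → BipyramidVertex m 3
    | .north => .north
    | .south => .south
    | .rim i => .rim i
    | .inner a => a.elim0
  have harc : ∀ a b, Arc m 0 a b → Arc m 3 (f a) (f b) := by
    intro a b h
    cases h with
    | north i => exact .north i
    | south i => exact .south i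
    | step i j h => exact .step i j h
    | closing i j h h' => exact .closing i j h h'
    | innerNorth a => exact a.elim0
    | innerRim a => exact a.elim0
    | inner a => exact a.elim0
  have hf : Function.Injective f := by
    rintro (_ | _ | i | a) (_ | _ | j | b) h <;>
      first | exact a.elim0 | exact b.elim0 | simp_all [f]
  refine (bipyramid_three_isPlanar hm).of_hom ⟨f, fun {a b} h ↦ ?_⟩ hf
  obtain ⟨hne, h⟩ := (fromRel_adj _ _ _).1 h
  exact (fromRel_adj _ _ _).2 ⟨hf.ne hne, h.imp (harc _ _) (harc _ _)⟩

/-! ### Maximality -/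

namespace BipyramidVertex

variable {m k : ℕ}

theorem Arc.adj (hm : 2 ≤ m) {a b : BipyramidVertex m k} (h : Arc m k a b) :
    (bipyramid m k).Adj a b := by
  refine (fromRel_adj _ _ _).2 ⟨?_, .inl h⟩
  rintro rfl
  exact h.irrefl hm

/-- The rim contains a path from `i` to `j` of length `d = j - i`. -/
theorem exists_rim_walk (hm : 2 ≤ m) (d : ℕ) : ∀ i j : Fin m, i.val + d = j.val →
    ∃ w : (bipyramid m k).Walk (rim i) (rim j), w.IsPath ∧ w.length = d ∧
      ∀ v ∈ w.support, ∃ l : Fin m, i ≤ l ∧ l ≤ j ∧ v = rim l := by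
  induction d with
  | zero =>
    intro i j h
    obtain rfl : i = j := Fin.ext h
    exact ⟨.nil, .nil, rfl, fun v hv ↦ ⟨i, le_rfl, le_rfl, by simpa using hv⟩⟩
  | succ d ih =>
    intro i j h
    obtain ⟨w, hw, hlen, hsupp⟩ := ih ⟨i.val + 1, by omega⟩ j (by simp only; omega)
    refine ⟨.cons ((Arc.step i _ rfl).adj hm) w, ?_, by simp [hlen], ?_⟩
    · rw [Walk.cons_isPath_iff]
      refine ⟨hw, fun hi ↦ ?_⟩
      obtain ⟨l, hl, -, hl'⟩ := hsupp _ hi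
      rw [rim.injEq] at hl'
      subst hl'
      exact absurd (Fin.le_def.1 hl) (by simp)
    · intro v hv
      rw [Walk.support_cons, List.mem_cons] at hv
      rcases hv with rfl | hv
      · exact ⟨i, le_rfl, Fin.le_def.2 (by omega), rfl⟩
      · obtain ⟨l, hl, hl', rfl⟩ := hsupp v hv
        exact ⟨l, Fin.le_def.2 (by have := Fin.le_def.1 hl; simp only at this; omega), hl', rfl⟩

theorem exists_rim_neighbours (hm : 4 ≤ m) (i : Fin m) : ∃ p q : Fin m, p ≠ q ∧
    (bipyramid m k).Adj (rim i) (rim p) ∧ (bipyramid m k).Adj (rim i) (rim q) := by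
  by_cases h0 : i.val = 0
  · exact ⟨⟨1, by omega⟩, ⟨m - 1, by omega⟩, by simp only [ne_eq, Fin.mk.injEq]; omega,
      (Arc.step _ _ (by simp [h0])).adj (by omega),
      (Arc.closing _ _ h0 (by simp only; omega)).adj (by omega)⟩
  by_cases h1 : i.val + 1 = m
  · exact ⟨⟨i - 1, by omega⟩, ⟨0, by omega⟩, by simp only [ne_eq, Fin.mk.injEq]; omega,
      ((Arc.step _ _ (by simp only; omega)).adj (by omega)).symm,
      ((Arc.closing _ _ rfl h1).adj (by omega)).symm⟩
  · exact ⟨⟨i - 1, by omega⟩, ⟨i + 1, by omega⟩, by simp only [ne_eq, Fin.mk.injEq]; omega,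
      ((Arc.step _ _ (by simp only; omega)).adj (by omega)).symm,
      (Arc.step _ _ rfl).adj (by omega)⟩

/-- If the new edge joins `i` to `j`, then `i, north, south` and `j, i - 1, i + 1` form a
`K₃,₃`. -/
theorem not_isPlanar_sup_rim_rim (hm : 4 ≤ m) {i j : Fin m} (hij : i ≠ j)
    (h : ¬ (bipyramid m k).Adj (rim i) (rim j)) :
    ¬ (bipyramid m k ⊔ edge (rim i) (rim j)).IsPlanar := by
  obtain ⟨p, q, hpq, hp, hq⟩ := exists_rim_neighbours (k := k) hm i
  have hpi : i ≠ p := by rintro rfl; exact hp.ne rfl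
  have hqi : i ≠ q := by rintro rfl; exact hq.ne rfl
  have hpj : j ≠ p := by rintro rfl; exact h hp
  have hqj : j ≠ q := by rintro rfl; exact h hq
  have hm' : 2 ≤ m := by omega
  have hnew : (bipyramid m k ⊔ edge (rim i) (rim j)).Adj (rim i) (rim j) :=
    .inr ((edge_adj _ _ _ _).2 ⟨.inl ⟨rfl, rfl⟩, by simpa⟩)
  exact not_isPlanar_of_walk (a₀ := rim i) (a₁ := north) (a₂ := south) (b₀ := rim j)
    (b₁ := rim p) (b₂ := rim q) (by simp [*]) hnew.toWalk
    (by simp [*]) (.inl hp) (.inl hq) (.inl ((Arc.north j).adj hm')) (.inl ((Arc.north p).adj hm'))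
    (.inl ((Arc.north q).adj hm')) (.inl ((Arc.south j).adj hm')) (.inl ((Arc.south p).adj hm'))
    (.inl ((Arc.south q).adj hm'))

/-- With the new edge, `0, 2, north` and `1, 3, south` form a subdivided `K₃,₃`, in which `0` and
`3` are connected along the rest of the rim. -/
theorem not_isPlanar_sup_north_south (hm : 4 ≤ m) :
    ¬ (bipyramid m k ⊔ edge north south).IsPlanar := by
  have hm' : 2 ≤ m := by omega
  obtain ⟨v₀, h₀⟩ : ∃ i : Fin m, i.val = 0 := ⟨⟨0, by omega⟩, rfl⟩
  obtain ⟨v₁, h₁⟩ : ∃ i : Fin m, i.val = 1 := ⟨⟨1, by omega⟩, rfl⟩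
  obtain ⟨v₂, h₂⟩ : ∃ i : Fin m, i.val = 2 := ⟨⟨2, by omega⟩, rfl⟩
  obtain ⟨v₃, h₃⟩ : ∃ i : Fin m, i.val = 3 := ⟨⟨3, by omega⟩, rfl⟩
  obtain ⟨l, hl⟩ : ∃ i : Fin m, i.val + 1 = m := ⟨⟨m - 1, by omega⟩, by simp only; omega⟩
  obtain ⟨w, -, -, hw⟩ := exists_rim_walk (k := k) hm' (m - 4) v₃ l (by omega)
  have hnew : (bipyramid m k ⊔ edge north south).Adj north south :=
    .inr ((edge_adj _ _ _ _).2 ⟨.inl ⟨rfl, rfl⟩, by simp⟩)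
  let w' := (Walk.cons ((Arc.closing v₀ l h₀ hl).adj hm') w.reverse).mapLe
    (le_sup_left (b := edge north south))
  refine not_isPlanar_of_walk (a₀ := rim v₀) (a₁ := rim v₂) (a₂ := north) (b₀ := rim v₃)
    (b₁ := rim v₁) (b₂ := south) (by simp [Fin.ext_iff, *]) w' ?_
    (.inl ((Arc.step v₀ v₁ (by omega)).adj hm')) (.inl ((Arc.south v₀).adj hm').symm)
    (.inl ((Arc.step v₂ v₃ (by omega)).adj hm')) (.inl ((Arc.step v₁ v₂ (by omega)).adj hm').symm)
    (.inl ((Arc.south v₂).adj hm').symm) (.inl ((Arc.north v₃).adj hm'))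
    (.inl ((Arc.north v₁).adj hm')) hnew
  intro x hx
  simp only [w', Walk.support_mapLe_eq_support, Walk.support_cons, Walk.support_reverse,
    List.mem_cons, List.mem_reverse] at hx
  rcases hx with rfl | hx
  · simp [Fin.ext_iff, *]
  · obtain ⟨i, hi, -, rfl⟩ := hw x hx
    have := Fin.le_def.1 hi
    simp only [ne_eq, rim.injEq, Fin.ext_iff, reduceCtorEq, not_false_eq_true, true_and, and_true]
    omega

/-- An inner vertex of the octahedron placed into the face `north, 0, 1` must not be joined to
anything but its neighbours. The new edge connects it to the opposite vertex of the octahedron,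
directly or by a path outside of the octahedron. Each class of the resulting `K₃,₃` consists of one
of these two vertices together with one of the other two opposite pairs. -/
theorem not_isPlanar_sup_inner (hm : 4 ≤ m) (a : Fin 3) {v : BipyramidVertex m 3}
    (hv : v ≠ inner a) (h : ¬ (bipyramid m 3).Adj (inner a) v) :
    ¬ (bipyramid m 3 ⊔ edge (inner a) v).IsPlanar := by
  have hm' : 2 ≤ m := by omega
  obtain ⟨v₀, h₀⟩ : ∃ i : Fin m, i.val = 0 := ⟨⟨0, by omega⟩, rfl⟩
  obtain ⟨v₁, h₁⟩ : ∃ i : Fin m, i.val = 1 := ⟨⟨1, by omega⟩, rfl⟩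
  have hne : v₀ ≠ v₁ := by simp [Fin.ext_iff, *]
  set G := bipyramid m 3 ⊔ edge (inner a) v with hG
  have hnew : G.Adj (inner a) v := .inr ((edge_adj _ _ _ _).2 ⟨.inl ⟨rfl, rfl⟩, hv.symm⟩)
  have lift : ∀ {x y}, Arc m 3 x y → G.Adj x y := fun h ↦ .inl (h.adj hm')
  have n0 : G.Adj north (rim v₀) := lift (.north _)
  have n1 : G.Adj north (rim v₁) := lift (.north _)
  have r01 : G.Adj (rim v₀) (rim v₁) := lift (.step _ _ (by omega))
  have x0 : G.Adj (inner 0) (rim v₀) := lift (.innerRim _ _ (by simp [*]))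
  have x1 : G.Adj (inner 0) (rim v₁) := lift (.innerRim _ _ (by simp [*]))
  have y1 : G.Adj (inner 1) (rim v₁) := lift (.innerRim _ _ (by simp [*]))
  have z0 : G.Adj (inner 2) (rim v₀) := lift (.innerRim _ _ (by simp [*]))
  have yn : G.Adj (inner 1) north := lift (.innerNorth _ (by simp))
  have zn : G.Adj (inner 2) north := lift (.innerNorth _ (by simp))
  have xy : G.Adj (inner 0) (inner 1) := lift (.inner _ _ (by decide))
  have xz : G.Adj (inner 0) (inner 2) := lift (.inner _ _ (by decide))
  have yz : G.Adj (inner 1) (inner 2) := lift (.inner _ _ (by decide))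
  -- it suffices to reach the vertex opposite to `inner a`
  have hmain : ∀ o : BipyramidVertex m 3,
      (a = 0 ∧ o = north ∨ a = 1 ∧ o = rim v₀ ∨ a = 2 ∧ o = rim v₁) → ∀ w : G.Walk o (inner a),
      (∀ x ∈ w.support, x = o ∨ x = inner a ∨ x ≠ north ∧ x ≠ rim v₀ ∧ x ≠ rim v₁ ∧
        ∀ b, x ≠ inner b) → ¬ G.IsPlanar := by
    rintro o (⟨rfl, rfl⟩ | ⟨rfl, rfl⟩ | ⟨rfl, rfl⟩) w hw
    · refine not_isPlanar_of_walk (a₀ := north) (a₁ := rim v₀) (a₂ := inner 1) (b₀ := inner 0)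
        (b₁ := rim v₁) (b₂ := inner 2) (by simp [hne]) w ?_ n1 zn.symm x0.symm r01 z0.symm xy.symm
        y1 yz
      intro x hx
      rcases hw x hx with rfl | rfl | h
      · simp
      · simp
      · simp [h]
    · refine not_isPlanar_of_walk (a₀ := rim v₀) (a₁ := north) (a₂ := inner 0) (b₀ := inner 1)
        (b₁ := rim v₁) (b₂ := inner 2) (by simp [hne]) w ?_ r01 z0.symm yn.symm n1 zn.symm xy x1 xz
      intro x hx
      rcases hw x hx with rfl | rfl | h
      · simp [hne]
      · simp
      · simp [h]
    · refine not_isPlanar_of_walk (a₀ := rim v₁) (a₁ := north) (a₂ := inner 0) (b₀ := inner 2)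
        (b₁ := rim v₀) (b₂ := inner 1) (by simp [hne.symm]) w ?_ r01.symm y1.symm zn.symm n0
        yn.symm xz x0 xy
      intro x hx
      rcases hw x hx with rfl | rfl | h
      · simp [hne.symm]
      · simp
      · simp [h]
  have hs : ∀ i, G.Adj south (rim i) := fun i ↦ lift (.south _)
  have ha : a = 0 ∨ a = 1 ∨ a = 2 := by
    fin_cases a <;> simp
  rcases v with _ | _ | i | b
  · -- the inner vertices other than `0` are adjacent to `north`
    rcases ha with rfl | rfl | rfl
    · exact hmain _ (.inl ⟨rfl, rfl⟩) hnew.symm.toWalk (by simp)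
    · exact absurd ((Arc.innerNorth _ (by simp)).adj hm') h
    · exact absurd ((Arc.innerNorth _ (by simp)).adj hm') h
  · rcases ha with rfl | rfl | rfl
    · obtain ⟨v₂, h₂⟩ : ∃ i : Fin m, i.val = 2 := ⟨⟨2, by omega⟩, rfl⟩
      exact hmain _ (.inl ⟨rfl, rfl⟩)
        (.cons (lift (.north v₂)) (.cons (hs v₂).symm hnew.symm.toWalk)) (by simp [Fin.ext_iff, *])
    · exact hmain _ (.inr (.inl ⟨rfl, rfl⟩)) (.cons (hs v₀).symm hnew.symm.toWalk) (by simp)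
    · exact hmain _ (.inr (.inr ⟨rfl, rfl⟩)) (.cons (hs v₁).symm hnew.symm.toWalk) (by simp)
  · rcases ha with rfl | rfl | rfl
    · have hi₀ : i ≠ v₀ := by
        rintro rfl; exact h ((Arc.innerRim _ _ (by simp [*])).adj hm')
      have hi₁ : i ≠ v₁ := by
        rintro rfl; exact h ((Arc.innerRim _ _ (by simp [*])).adj hm')
      exact hmain _ (.inl ⟨rfl, rfl⟩) (.cons (lift (.north i)) hnew.symm.toWalk) (by simp [*])
    · have hi₁ : i ≠ v₁ := by
        rintro rfl; exact h ((Arc.innerRim _ _ (by simp [*])).adj hm')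
      by_cases hi₀ : i = v₀
      · subst hi₀
        exact hmain _ (.inr (.inl ⟨rfl, rfl⟩)) hnew.symm.toWalk (by simp)
      · exact hmain _ (.inr (.inl ⟨rfl, rfl⟩))
          (.cons (hs v₀).symm (.cons (hs i) hnew.symm.toWalk)) (by simp [*])
    · have hi₀ : i ≠ v₀ := by
        rintro rfl; exact h ((Arc.innerRim _ _ (by simp [*])).adj hm')
      by_cases hi₁ : i = v₁
      · subst hi₁
        exact hmain _ (.inr (.inr ⟨rfl, rfl⟩)) hnew.symm.toWalk (by simp)
      · exact hmain _ (.inr (.inr ⟨rfl, rfl⟩))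
          (.cons (hs v₁).symm (.cons (hs i) hnew.symm.toWalk)) (by simp [*])
  · have hab : b ≠ a := fun h ↦ hv (congrArg _ h)
    rcases lt_or_gt_of_ne hab with hab | hab
    · exact absurd ((Arc.inner _ _ hab).adj hm').symm h
    · exact absurd ((Arc.inner _ _ hab).adj hm') h

theorem bipyramid_isMaximalPlanar (hm : 4 ≤ m) (hk : k = 0 ∨ k = 3) :
    (bipyramid m k).IsMaximalPlanar := by
  have hm' : 2 ≤ m := by omega
  refine ⟨?_, fun u v huv h ↦ ?_⟩
  · rcases hk with rfl | rfl
    exacts [bipyramid_zero_isPlanar hm, bipyramid_three_isPlanar hm]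
  have hinner : ∀ a v, v ≠ inner a → ¬ (bipyramid m k).Adj (inner a) v →
      ¬ (bipyramid m k ⊔ edge (inner a) v).IsPlanar := by
    rcases hk with rfl | rfl
    · exact fun a ↦ a.elim0
    · exact fun a v ↦ not_isPlanar_sup_inner hm a
  rcases u with _ | _ | i | a <;> rcases v with _ | _ | j | b
  · exact absurd rfl huv
  · exact not_isPlanar_sup_north_south hm
  · exact absurd ((Arc.north j).adj hm') h
  · rw [edge_comm]
    exact hinner b _ huv fun h' ↦ h h'.symm
  · rw [edge_comm]
    exact not_isPlanar_sup_north_south hm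
  · exact absurd rfl huv
  · exact absurd ((Arc.south j).adj hm') h
  · rw [edge_comm]
    exact hinner b _ huv fun h' ↦ h h'.symm
  · exact absurd ((Arc.north i).adj hm').symm h
  · exact absurd ((Arc.south i).adj hm').symm h
  · exact not_isPlanar_sup_rim_rim hm (fun h ↦ huv (congrArg _ h)) h
  · rw [edge_comm]
    exact hinner b _ huv fun h' ↦ h h'.symm
  all_goals exact hinner a _ huv.symm h

/-! ### The Hamiltonian cycle -/

theorem bipyramid_isHamiltonian (hm : 4 ≤ m) (hk : k = 0 ∨ k = 3) :
    (bipyramid m k).IsHamiltonian := by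
  have hm' : 2 ≤ m := by omega
  obtain ⟨v₀, h₀⟩ : ∃ i : Fin m, i.val = 0 := ⟨⟨0, by omega⟩, rfl⟩
  obtain ⟨v₁, h₁⟩ : ∃ i : Fin m, i.val = 1 := ⟨⟨1, by omega⟩, rfl⟩
  obtain ⟨l, hl⟩ : ∃ i : Fin m, i.val + 1 = m := ⟨⟨m - 1, by omega⟩, by simp only; omega⟩
  obtain ⟨w, hw, hlen, hsupp⟩ := exists_rim_walk (k := k) hm' (m - 2) v₁ l (by omega)
  have hne : ∀ i, v₁ ≤ i → v₀ ≠ i := by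
    rintro i hi rfl
    have := Fin.le_def.1 hi
    omega
  -- the path `0, south, 1, 2, …, m - 1, north`
  let w₁ : (bipyramid m k).Walk (rim v₀) north :=
    .cons ((Arc.south v₀).adj hm').symm (.cons ((Arc.south v₁).adj hm')
      (w.concat ((Arc.north l).adj hm').symm))
  have hw₁ : w₁.IsPath := by
    have hn : north ∉ w.support := fun h ↦ by
      obtain ⟨_, _, _, h⟩ := hsupp _ h
      cases h
    have hs : south ∉ w.support := fun h ↦ by
      obtain ⟨_, _, _, h⟩ := hsupp _ h
      cases h
    have h0 : rim v₀ ∉ w.support := fun h ↦ by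
      obtain ⟨i, hi, _, h⟩ := hsupp _ h
      exact hne i hi (rim.inj h)
    simp [w₁, Walk.cons_isPath_iff, Walk.concat_isPath_iff, Walk.support_concat, *]
  have hlen₁ : w₁.length = m + 1 := by
    simp only [w₁, Walk.length_cons, Walk.length_concat, hlen]
    omega
  intro _
  refine ⟨north, ?_⟩
  simp_rw [Walk.isHamiltonianCycle_iff_isCycle_and_length_eq,
    Walk.isCycle_iff_isPath_tail_and_le_length, card_eq]
  rcases hk with rfl | rfl
  · refine ⟨.cons ((Arc.north v₀).adj hm') w₁, ⟨by simpa using hw₁, ?_⟩, ?_⟩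
    · simp only [Walk.length_cons, hlen₁]
      omega
    · simp only [Walk.length_cons, hlen₁]
  · have hin : ∀ a, inner a ∉ w₁.support := by
      intro a ha
      have : inner a ∉ w.support := fun h ↦ by
        obtain ⟨_, _, _, h⟩ := hsupp _ h
        cases h
      simp [w₁, Walk.support_concat, this] at ha
    -- the detour `north, inner 1, inner 0, inner 2, 0` replaces the edge from `north` to `0`
    refine ⟨.cons ((Arc.innerNorth 1 (by simp)).adj hm').symm
      (.cons ((Arc.inner 0 1 (by decide)).adj hm').symm
      (.cons ((Arc.inner 0 2 (by decide)).adj hm')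
      (.cons ((Arc.innerRim 2 v₀ (by simp [h₀])).adj hm') w₁))), ⟨?_, ?_⟩, ?_⟩
    · simp [Walk.cons_isPath_iff, hw₁, hin]
    · simp only [Walk.length_cons, hlen₁]
      omega
    · simp only [Walk.length_cons, hlen₁]

end BipyramidVertex

/-! ### The decomposition into triangles -/

/-- A family of triangles such that every edge has both ends in exactly one of them is a
decomposition into triangles. -/
theorem SimpleGraph.isTriangleDecomposable_of_existsUnique {V ι : Type*} {G : SimpleGraph V}
    (S : ι → Set V)
    (hS : ∀ l, ∃ a b c, G.Adj a b ∧ G.Adj a c ∧ G.Adj b c ∧ S l = {a, b, c})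
    (huniq : ∀ u v, G.Adj u v → ∃! l, u ∈ S l ∧ v ∈ S l) : G.IsTriangleDecomposable := by
  let T (l : ι) : Set (Sym2 V) := {e | e ∈ G.edgeSet ∧ ∀ v ∈ e, v ∈ S l}
  refine ⟨Set.range T, ?_, ?_, ?_⟩
  · rintro _ ⟨l, rfl⟩
    obtain ⟨a, b, c, hab, hac, hbc, hl⟩ := hS l
    refine ⟨a, b, c, hab.ne, hac.ne, hbc.ne, ?_⟩
    ext ⟨u, v⟩
    simp only [T, hl, Set.mem_ofPred_eq, Set.mem_insert_iff, Set.mem_singleton_iff]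
    constructor
    · rintro ⟨huv, h⟩
      have huv : G.Adj u v := huv
      have hu := h u (Sym2.mem_mk_left u v)
      have hv := h v (Sym2.mem_mk_right u v)
      have hne := huv.ne
      rcases hu with rfl | rfl | rfl <;> rcases hv with rfl | rfl | rfl <;>
        first | exact absurd rfl hne | simp
    · rintro (h | h | h)
      · exact ⟨h ▸ hab, by simp [h]⟩
      · exact ⟨h ▸ hac, by simp [h]⟩
      · exact ⟨h ▸ hbc, by simp [h]⟩
  · rintro _ ⟨l, rfl⟩ _ ⟨l', rfl⟩ hne
    rw [Function.onFun, id, id, Set.disjoint_left]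
    rintro ⟨u, v⟩ ⟨huv, h⟩ ⟨-, h'⟩
    refine hne (congrArg T ((huniq u v huv).unique ⟨?_, ?_⟩ ⟨?_, ?_⟩))
    exacts [h u (Sym2.mem_mk_left u v), h v (Sym2.mem_mk_right u v),
      h' u (Sym2.mem_mk_left u v), h' v (Sym2.mem_mk_right u v)]
  · ext ⟨u, v⟩
    simp only [Set.sUnion_range, Set.mem_iUnion]
    constructor
    · rintro ⟨l, h, -⟩
      exact h
    · intro huv
      obtain ⟨l, ⟨hu, hv⟩, -⟩ := huniq u v huv
      refine ⟨l, huv, fun x hx ↦ ?_⟩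
      rcases Sym2.mem_iff.1 hx with rfl | rfl
      exacts [hu, hv]

namespace BipyramidVertex

variable {m k : ℕ}

/-- The triangles of the decomposition, as sets of vertices. The triangle of `l : Fin m` has the
side `l, l + 1` of the rim and the apex `north` or `south` according to the parity of `l`; the
triangles of `Fin k` are those faces of the octahedron that share just a corner with the face
`north, 0, 1`. -/
def triangle : Fin m ⊕ Fin k → Set (BipyramidVertex m k)
  | .inl l => {v | match v with
    | north => l.val % 2 = 0
    | south => l.val % 2 = 1
    | rim i => i.val = l.val ∨ i.val = l.val + 1 ∨ i.val = 0 ∧ l.val + 1 = m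
    | inner _ => False}
  | .inr j => {v | match v with
    | north => j.val = 2
    | south => False
    | rim i => j.val = 0 ∧ i.val = 0 ∨ j.val = 1 ∧ i.val = 1
    | inner a => a.val = 0 ∧ j.val ≤ 1 ∨ a.val = 1 ∧ 1 ≤ j.val ∨ a.val = 2 ∧ j.val ≠ 1}

theorem existsUnique_triangle (hm : 4 ≤ m) (hm2 : m % 2 = 0) (hk : k = 0 ∨ k = 3)
    {u v : BipyramidVertex m k} (h : Arc m k u v) :
    ∃! l, u ∈ triangle l ∧ v ∈ triangle l := by
  cases h with
  | north i =>
    refine ⟨.inl ⟨i.val - i.val % 2, by omega⟩, ?_, ?_⟩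
    · simp only [triangle, Set.mem_ofPred_eq]; grind
    · rintro (l | j) <;> simp only [triangle, Set.mem_ofPred_eq, Sum.inl.injEq, reduceCtorEq,
        Fin.ext_iff] <;> grind
  | south i =>
    refine ⟨.inl ⟨if i.val = 0 then m - 1 else i.val - (i.val + 1) % 2, by split_ifs <;> omega⟩,
      ?_, ?_⟩
    · simp only [triangle, Set.mem_ofPred_eq]; grind
    · rintro (l | j) <;> simp only [triangle, Set.mem_ofPred_eq, Sum.inl.injEq, reduceCtorEq,
        Fin.ext_iff] <;> grind
  | step i j h =>
    refine ⟨.inl i, ?_, ?_⟩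
    · simp only [triangle, Set.mem_ofPred_eq]; grind
    · rintro (l | j) <;> simp only [triangle, Set.mem_ofPred_eq, Sum.inl.injEq, reduceCtorEq,
        Fin.ext_iff] <;> grind
  | closing i j hi hj =>
    refine ⟨.inl j, ?_, ?_⟩
    · simp only [triangle, Set.mem_ofPred_eq]; grind
    · rintro (l | j) <;> simp only [triangle, Set.mem_ofPred_eq, Sum.inl.injEq, reduceCtorEq,
        Fin.ext_iff] <;> grind
  | innerNorth a h =>
    refine ⟨.inr ⟨2, by omega⟩, ?_, ?_⟩
    · simp only [triangle, Set.mem_ofPred_eq]; grind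
    · rintro (l | j) <;> simp only [triangle, Set.mem_ofPred_eq, Sum.inr.injEq, reduceCtorEq,
        Fin.ext_iff] <;> grind
  | innerRim a i h =>
    refine ⟨.inr ⟨i.val, by omega⟩, ?_, ?_⟩
    · simp only [triangle, Set.mem_ofPred_eq]; grind
    · rintro (l | j) <;> simp only [triangle, Set.mem_ofPred_eq, Sum.inr.injEq, reduceCtorEq,
        Fin.ext_iff] <;> grind
  | inner a b h =>
    rw [Fin.lt_def] at h
    -- the pairs `{0, 1}`, `{0, 2}`, `{1, 2}` belong to the triangles `1`, `0`, `2`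
    refine ⟨.inr ⟨if a.val = 1 then 2 else 2 - b.val, by split_ifs <;> omega⟩, ?_, ?_⟩
    · simp only [triangle, Set.mem_ofPred_eq]; grind
    · rintro (l | j) <;> simp only [triangle, Set.mem_ofPred_eq, Sum.inr.injEq, reduceCtorEq,
        Fin.ext_iff] <;> grind

theorem bipyramid_isTriangleDecomposable (hm : 4 ≤ m) (hm2 : m % 2 = 0) (hk : k = 0 ∨ k = 3) :
    (bipyramid m k).IsTriangleDecomposable := by
  have hm' : 2 ≤ m := by omega
  refine isTriangleDecomposable_of_existsUnique triangle ?_ fun u v huv ↦ ?_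
  · rintro (l | j)
    · obtain ⟨l', hl', hadj⟩ : ∃ l' : Fin m,
          (l'.val = l.val + 1 ∨ l'.val = 0 ∧ l.val + 1 = m) ∧
          (bipyramid m k).Adj (rim l) (rim l') := by
        by_cases h : l.val + 1 = m
        · exact ⟨⟨0, by omega⟩, .inr ⟨rfl, h⟩, ((Arc.closing _ _ rfl h).adj hm').symm⟩
        · exact ⟨⟨l + 1, by omega⟩, .inl rfl, (Arc.step _ _ rfl).adj hm'⟩
      by_cases hl : l.val % 2 = 0
      · refine ⟨north, rim l, rim l', (Arc.north l).adj hm', (Arc.north l').adj hm', hadj, ?_⟩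
        ext (_ | _ | i | a) <;>
          simp only [triangle, Set.mem_ofPred_eq, Set.mem_insert_iff, Set.mem_singleton_iff,
            reduceCtorEq, rim.injEq, Fin.ext_iff] <;> grind
      · refine ⟨south, rim l, rim l', (Arc.south l).adj hm', (Arc.south l').adj hm', hadj, ?_⟩
        ext (_ | _ | i | a) <;>
          simp only [triangle, Set.mem_ofPred_eq, Set.mem_insert_iff, Set.mem_singleton_iff,
            reduceCtorEq, rim.injEq, Fin.ext_iff] <;> grind
    · obtain rfl : k = 3 := by
        have := j.isLt
        omega
      obtain ⟨v₀, h₀⟩ : ∃ i : Fin m, i.val = 0 := ⟨⟨0, by omega⟩, rfl⟩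
      obtain ⟨v₁, h₁⟩ : ∃ i : Fin m, i.val = 1 := ⟨⟨1, by omega⟩, rfl⟩
      have hj : j = 0 ∨ j = 1 ∨ j = 2 := by
        fin_cases j <;> simp
      have val0 : (0 : Fin 3).val = 0 := rfl
      have val1 : (1 : Fin 3).val = 1 := rfl
      have val2 : (2 : Fin 3).val = 2 := rfl
      rcases hj with rfl | rfl | rfl
      · refine ⟨inner 0, inner 2, rim v₀, (Arc.inner _ _ (by decide)).adj hm',
          (Arc.innerRim _ _ (by simp [h₀])).adj hm', (Arc.innerRim _ _ (by simp [h₀])).adj hm', ?_⟩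
        ext (_ | _ | i | a) <;>
          simp only [triangle, Set.mem_ofPred_eq, Set.mem_insert_iff, Set.mem_singleton_iff,
            reduceCtorEq, rim.injEq, inner.injEq, Fin.ext_iff, val0, val2] <;> grind
      · refine ⟨inner 0, inner 1, rim v₁, (Arc.inner _ _ (by decide)).adj hm',
          (Arc.innerRim _ _ (by simp [h₁])).adj hm', (Arc.innerRim _ _ (by simp [h₁])).adj hm', ?_⟩
        ext (_ | _ | i | a) <;>
          simp only [triangle, Set.mem_ofPred_eq, Set.mem_insert_iff, Set.mem_singleton_iff,
            reduceCtorEq, rim.injEq, inner.injEq, Fin.ext_iff, val0, val1] <;> grind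
      · refine ⟨inner 1, inner 2, north, (Arc.inner _ _ (by decide)).adj hm',
          (Arc.innerNorth _ (by simp)).adj hm', (Arc.innerNorth _ (by simp)).adj hm', ?_⟩
        ext (_ | _ | i | a) <;>
          simp only [triangle, Set.mem_ofPred_eq, Set.mem_insert_iff, Set.mem_singleton_iff,
            reduceCtorEq, inner.injEq, Fin.ext_iff, val1, val2] <;> grind
  · obtain ⟨-, h | h⟩ := (fromRel_adj _ _ _).1 huv
    · exact existsUnique_triangle hm hm2 hk h
    · simpa only [and_comm] using existsUnique_triangle hm hm2 hk h

end BipyramidVertex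

theorem theorem11 (n : ℕ) (hn : 6 ≤ n) (hn7 : n ≠ 7) :
    ∃ G : SimpleGraph (Fin n),
      G.IsHamiltonian ∧ G.IsMaximalPlanar ∧ G.IsTriangleDecomposable := by
  obtain ⟨m, k, hm, hm2, hk, hmk⟩ : ∃ m k, 4 ≤ m ∧ m % 2 = 0 ∧ (k = 0 ∨ k = 3) ∧
      m + k + 2 = n := by
    rcases Nat.mod_two_eq_zero_or_one n with h | h
    · exact ⟨n - 2, 0, by omega, by omega, .inl rfl, by omega⟩
    · exact ⟨n - 5, 3, by omega, by omega, .inr rfl, by omega⟩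
  exact exists_of_card_eq ((card_eq m k).trans hmk) ⟨bipyramid_isHamiltonian hm hk,
    bipyramid_isMaximalPlanar hm hk, bipyramid_isTriangleDecomposable hm hm2 hk⟩
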